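/- Let $G$ be a finite group, let $L(G)$ be the set of all subgroups of $G$, and let $N_G=\{N_G(H)\mid H\in L(G)\}$ be the set of all normalizers of subgroups of $G$. Write $\mathbb{Z}_n$ for the cyclic group of order $n$. A ZM-group is a finite non-abelian group all of whose Sylow subgroups are cyclic. Then: a) $|N_G|=|L(G)|-1$ if and only if $G\cong\mathbb{Z}_p$ for some prime $p$. b) $|N_G|=|L(G)|-2$ if and only if $G\cong\mathbb{Z}_{p^2}$ for some prime $p$, or $G$ is isomorphic to a semidirect product $\mathbb{Z}_p\rtimes\mathbb{Z}_q$ with non-trivial action, for some primes $p,q$ with $q\mid p-1$. c) $|N_G|=|L(G)|-3$ if and only if $G\cong\mathbb{Z}_{p^3}$ for some prime $p$, or $G\cong\mathbb{Z}_{pq}$ for some distinct primes $p,q$, or $G$ is isomorphic to a semidirect product $\mathbb{Z}_{p^2}\rtimes\mathbb{Z}_q$ with non-trivial action, for some primes $p,q$ with $q\mid p-1$. d) If $G$ is not a ZM-group, then $|N_G|=|L(G)|-4$ if and only if $G\cong\mathbb{Z}_{p^4}$ for some prime $p$, or $G\cong\mathbb{Z}_2\times\mathbb{Z}_2$, or $G\cong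 A_4$, the alternating group of degree $4$. -/

import Mathlib

/-- The set `N_G = {N_G(H) | H ≤ G}` of all normalizers of subgroups of `G`. -/
def normalizerSet (G : Type*) [Group G] : Set (Subgroup G) :=
  {K | ∃ H : Subgroup G, K = Subgroup.normalizer (H : Set G)}

/-- A ZM-group: a finite non-abelian group all of whose Sylow subgroups are cyclic. -/
def IsZMGroup (G : Type*) [Group G] : Prop :=
  Finite G ∧ (¬ ∀ a b : G, a * b = b * a) ∧
    ∀ p : ℕ, p.Prime → ∀ P : Sylow p G, IsCyclic P

/-- The (multiplicatively written) cyclic group of order `n` (for `n ≠ 0`). -/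
abbrev Cyc (n : ℕ) : Type := Multiplicative (ZMod n)

/-- `G` is isomorphic to a semidirect product of the cyclic group of order `m` (the normal factor)
by the cyclic group of order `n`, formed with respect to a non-trivial action. -/
def IsNontrivialSemidirect (G : Type*) [Group G] (m n : ℕ) : Prop :=
  ∃ φ : Cyc n →* MulAut (Cyc m), φ ≠ 1 ∧ Nonempty (G ≃* Cyc m ⋊[φ] Cyc n)

/-! Put d(G) = |L(G)| - |N_G|, the number of values lost by the map sending H to its normalizer. If
the subgroups in S have normalizers in T, then |S| ≤ |T| + d(G)
(`ncard_le_ncard_add_normalizerDefect`). So when d(G) ≤ 4 there are at most five normal subgroups,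
and this forces the structure of G.

A nilpotent non-abelian group has six normal subgroups, so a nilpotent G is abelian and d(G) =
|L(G)| - 1. Otherwise some Sylow subgroup P is not normal. Counting conjugates of P and of its
normalizer shows that P is self-normalizing (`normal_or_normalizer_eq_self`). Proper subgroups of P
that P normalizes are then normal in G, so P is cyclic. Burnside's transfer theorem gives a normal
complement K, which is nilpotent by a Frattini argument. If |P| is not prime, five normal subgroups
already appear, so d(G) = 4 and G is a ZM-group. If |P| = p, then K is abelian and every subgroup
not inside K is self-normalizing.

In that last case only the subgroups of K lose values. If all of them are normal in G, then d(G) =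
|L(K)|, so K is cyclic and d(G) is a number of divisors. If not, d(G) = |L(K)| - 1 with K not
cyclic, so K is a Klein four-group, p = 3 and G is A₄. The theorem follows on reading off which n
have 1, 2, 3, 4 or 5 divisors, and the converses use the same two counts. -/

open Subgroup

/-- The difference between the number of subgroups and the number of normalizers of subgroups. -/
noncomputable def normalizerDefect (G : Type*) [Group G] : ℕ :=
  Nat.card (Subgroup G) - (normalizerSet G).ncard

theorem normalizerSet_eq_range (G : Type*) [Group G] :
    normalizerSet G = Set.range fun H : Subgroup G => normalizer (H : Set G) := by
  ext K
  simp [normalizerSet, eq_comm]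

/-- For finite groups the truncated subtraction in `normalizerDefect` is a true one. -/
theorem ncard_add_normalizerDefect (G : Type*) [Group G] [Finite G] :
    (normalizerSet G).ncard + normalizerDefect G = Nat.card (Subgroup G) := by
  have h : (normalizerSet G).ncard ≤ Nat.card (Subgroup G) := by
    rw [← Set.ncard_univ]
    exact Set.ncard_le_ncard (Set.subset_univ _)
  unfold normalizerDefect
  omega

theorem ncard_eq_card_sub_iff (G : Type*) [Group G] [Finite G] (k : ℕ) :
    ((normalizerSet G).ncard : ℤ) = (Nat.card (Subgroup G) : ℤ) - k ↔ normalizerDefect G = k := by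
  have := ncard_add_normalizerDefect G
  omega

theorem normalizerDefect_congr {G G' : Type*} [Group G] [Group G'] (e : G ≃* G') :
    normalizerDefect G = normalizerDefect G' := by
  have h1 : Nat.card (Subgroup G) = Nat.card (Subgroup G') :=
    Nat.card_congr e.mapSubgroup.toEquiv
  have h2 : normalizerSet G' = e.mapSubgroup '' normalizerSet G := by
    simp only [normalizerSet_eq_range, ← Set.range_comp]
    rw [← e.mapSubgroup.surjective.range_comp]
    congr 1
    ext1 H
    simpa using (Subgroup.map_equiv_normalizer_eq H e).symm
  unfold normalizerDefect
  rw [h1, h2, Set.ncard_image_of_injective _ e.mapSubgroup.injective]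

/-! ### Lower bounds for the defect by counting conjugates -/

section Finite

variable {G : Type*} [Group G]

/-- Subgroups outside S contribute at most one normalizer each, so the loss inside S is at most the
whole defect. With T = {⊤}, having m normal subgroups gives defect at least m - 1. -/
theorem ncard_le_ncard_add_normalizerDefect [Finite G] (S T : Set (Subgroup G))
    (h : ∀ H ∈ S, normalizer (H : Set G) ∈ T) : S.ncard ≤ T.ncard + normalizerDefect G := by
  have h1 : normalizerSet G ⊆ T ∪ (fun H : Subgroup G => normalizer (H : Set G)) '' Sᶜ := by
    rw [normalizerSet_eq_range]
    rintro _ ⟨H, rfl⟩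
    by_cases hH : H ∈ S
    · exact Or.inl (h H hH)
    · exact Or.inr ⟨H, hH, rfl⟩
  have h2 := (Set.ncard_le_ncard h1).trans (Set.ncard_union_le _ _)
  have h3 := Set.ncard_image_le (f := fun H : Subgroup G => normalizer (H : Set G))
    (Set.toFinite Sᶜ)
  have h4 := Set.ncard_add_ncard_compl S
  have h5 := ncard_add_normalizerDefect G
  omega

/-- The set of conjugates of a subgroup. -/
def conjugates (H : Subgroup G) : Set (Subgroup G) :=
  Set.range fun g : G => H.map (MulAut.conj g).toMonoidHom

theorem ncard_conjugates (H : Subgroup G) :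
    (conjugates H).ncard = (normalizer (H : Set G)).index := by
  rw [Subgroup.index_eq_card, ← Nat.card_coe_set_eq]
  symm
  have key : ∀ a b : G, a⁻¹ * b ∈ normalizer (H : Set G) ↔
      H.map (MulAut.conj a).toMonoidHom = H.map (MulAut.conj b).toMonoidHom := fun a b => by
    rw [mem_normalizer_iff_map_conj_eq]
    have h1 : (H.map (MulAut.conj (a⁻¹ * b)).toMonoidHom).map (MulAut.conj a).toMonoidHom =
        H.map (MulAut.conj b).toMonoidHom := by
      rw [Subgroup.map_map]
      congr 1
      ext x
      simp [mul_assoc]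
    rw [← h1]
    exact ⟨fun h => congrArg _ h.symm,
      fun h => (Subgroup.map_injective (MulAut.conj a).injective h).symm⟩
  refine Nat.card_congr (Equiv.ofBijective (fun q => Quotient.liftOn' q
    (fun g => (⟨H.map (MulAut.conj g).toMonoidHom, g, rfl⟩ : conjugates H)) ?_) ⟨?_, ?_⟩)
  · intro a b hab
    exact Subtype.ext ((key a b).1 (QuotientGroup.leftRel_apply.1 hab))
  · rintro ⟨a⟩ ⟨b⟩ hab
    exact Quotient.sound' (QuotientGroup.leftRel_apply.2 ((key a b).2 (congrArg Subtype.val hab)))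
  · rintro ⟨_, g, rfl⟩
    exact ⟨QuotientGroup.mk g, rfl⟩

theorem normalizer_mem_conjugates {H H' : Subgroup G} (h : H' ∈ conjugates H) :
    normalizer (H' : Set G) ∈ conjugates (normalizer (H : Set G)) := by
  obtain ⟨g, rfl⟩ := h
  exact ⟨g, Subgroup.map_equiv_normalizer_eq H (MulAut.conj g)⟩

/-- With trivial core the action on the cosets of M is faithful. -/
theorem card_dvd_factorial_index_of_normalCore_eq_bot [Finite G] (M : Subgroup G) (hc : M.normalCore = ⊥) :
    Nat.card G ∣ M.index.factorial := by
  rw [← Subgroup.index_bot, ← hc, normalCore_eq_ker, index_ker, index_eq_card, ← Nat.card_perm]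
  exact card_subgroup_dvd_card (MulAction.toPermHom G (G ⧸ M)).range

theorem normal_of_mem_conjugates {H H' : Subgroup G} (h : H' ∈ conjugates H) (hn : H'.Normal) :
    H.Normal := by
  obtain ⟨g, rfl⟩ := h
  have : (H.map (MulAut.conj g).toMonoidHom).map (MulAut.conj g⁻¹).toMonoidHom = H := by
    rw [Subgroup.map_map]
    convert Subgroup.map_id H
    ext x
    simp [mul_assoc]
  rw [← this]
  exact hn.map _ (MulAut.conj g⁻¹).surjective

/-- If M = N(Q) differs from both Q and G, then Q and M have equally many conjugates, with only the
conjugates of M as normalizers. This wastes [G : M] values, too many for a small defect. -/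
theorem normal_or_normalizer_eq_self [Finite G] (hf : normalizerDefect G ≤ 4) (Q : Subgroup G)
    (hQ : normalizer (normalizer (Q : Set G) : Set G) = normalizer (Q : Set G)) :
    Q.Normal ∨ normalizer (Q : Set G) = Q := by
  by_contra! hcon
  obtain ⟨hn, hne⟩ := hcon
  set M := normalizer (Q : Set G) with hM
  have hMtop : M ≠ ⊤ := fun h => hn (normalizer_eq_top_iff.1 h)
  have hMn : ¬ M.Normal := fun h => hMtop (by rw [← hQ]; exact normalizer_eq_top_iff.2 h)
  have hi1 : M.index ≠ 1 := fun h => hMtop (index_eq_one.1 h)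
  have hi2 : M.index ≠ 2 := fun h => hMn (normal_of_index_eq_two h)
  have hi0 : M.index ≠ 0 := index_ne_zero_of_finite
  -- If a conjugate of Q equals a conjugate of M, taking normalizers of both gives Q = M.
  have hdisj : Disjoint (conjugates Q) (conjugates M) := by
    rw [Set.disjoint_left]
    rintro _ ⟨a, rfl⟩ ⟨b, hb⟩
    simp only at hb
    have h1 := congrArg (fun H : Subgroup G => normalizer (H : Set G)) hb
    simp only [← Subgroup.map_equiv_normalizer_eq _ (MulAut.conj _), hQ, ← hM] at h1
    exact hne (Subgroup.map_injective (MulAut.conj a).injective (h1.symm.trans hb))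
  have hcount : ∀ S : Set (Subgroup G), (∀ H ∈ S, H.Normal) →
      M.index + S.ncard ≤ 1 + normalizerDefect G := fun S hS => by
    have hd : Disjoint (conjugates Q ∪ conjugates M) S := by
      rw [Set.disjoint_left]
      rintro H (h | h) hHS
      · exact hn (normal_of_mem_conjugates h (hS H hHS))
      · exact hMn (normal_of_mem_conjugates h (hS H hHS))
    have := ncard_le_ncard_add_normalizerDefect ((conjugates Q ∪ conjugates M) ∪ S)
      (conjugates M ∪ {⊤}) (by
        rintro H ((h | h) | h)
        · exact Or.inl (normalizer_mem_conjugates h)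
        · left; simpa only [hQ] using normalizer_mem_conjugates h
        · exact Or.inr (normalizer_eq_top_iff.2 (hS H h)))
    rw [Set.ncard_union_eq hd, Set.ncard_union_eq hdisj] at this
    have h2 := Set.ncard_union_le (conjugates M) {⊤}
    rw [Set.ncard_singleton] at h2
    rw [ncard_conjugates, ncard_conjugates, hQ, ← hM] at this
    rw [ncard_conjugates, hQ] at h2
    omega
  have hbt : (⊥ : Subgroup G) ≠ ⊤ := fun h => hMtop (top_le_iff.1 (h ▸ bot_le))
  have h2 := hcount {⊥, ⊤} (by rintro H (rfl | rfl) <;> infer_instance)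
  rw [Set.ncard_pair hbt] at h2
  have hi3 : M.index = 3 := by omega
  -- At index 3, a trivial core gives |G| ∣ 6 and hence Q = ⊥. A nontrivial core is a third normal
  -- subgroup and breaks the count.
  by_cases hc : M.normalCore = ⊥
  · have h6 : Nat.card G ∣ 6 := by
      simpa [hi3, Nat.factorial] using card_dvd_factorial_index_of_normalCore_eq_bot M hc
    have hcM : Nat.card M ∣ 2 := by
      rw [← M.card_mul_index, hi3] at h6
      exact Nat.dvd_of_mul_dvd_mul_right (k := 3) (by norm_num) h6
    have hQM : Q < M := lt_of_le_of_ne le_normalizer (Ne.symm hne)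
    have hQ1 : Nat.card Q = 1 := by
      have h3 : Nat.card Q ∣ Nat.card M := card_dvd_of_le hQM.le
      have h4 : Nat.card Q < Nat.card M := by
        refine lt_of_le_of_ne (Nat.le_of_dvd Nat.card_pos h3) fun h => hne ?_
        exact (eq_of_le_of_card_ge hQM.le h.ge).symm
      have h5 := Nat.le_of_dvd two_pos hcM
      have h7 : 0 < Nat.card Q := Nat.card_pos
      omega
    exact hn (by rw [card_eq_one.1 hQ1]; infer_instance)
  · have h3 := hcount {⊥, M.normalCore, ⊤} (by rintro H (rfl | rfl | rfl) <;> infer_instance)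
    rw [Set.ncard_eq_three.2 ⟨⊥, M.normalCore, ⊤, Ne.symm hc, hbt,
      fun h => hMtop (top_le_iff.1 (h ▸ M.normalCore_le)), rfl⟩] at h3
    omega

/-- Every element of a noncyclic finite group lies in a maximal subgroup, and two proper subgroups
never cover a group: `a * y` escapes both `M₁` and `M₂`. -/
theorem exists_three_coatoms [Finite G] (h : ¬ IsCyclic G) :
    ∃ M₁ M₂ M₃ : Subgroup G, IsCoatom M₁ ∧ IsCoatom M₂ ∧ IsCoatom M₃ ∧
      M₁ ≠ M₂ ∧ M₁ ≠ M₃ ∧ M₂ ≠ M₃ := by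
  have key : ∀ x : G, ∃ M : Subgroup G, IsCoatom M ∧ x ∈ M := fun x => by
    rcases eq_top_or_exists_le_coatom (zpowers x) with h' | ⟨M, hM, hx⟩
    · exact (h (isCyclic_iff_exists_zpowers_eq_top.2 ⟨x, h'⟩)).elim
    · exact ⟨M, hM, hx (mem_zpowers x)⟩
  obtain ⟨M₁, h₁, -⟩ := key 1
  obtain ⟨y, hy⟩ : ∃ y, y ∉ M₁ := by
    by_contra! hc
    exact h₁.1 (eq_top_iff.2 fun x _ => hc x)
  obtain ⟨M₂, h₂, hy₂⟩ := key y
  have h12 : M₁ ≠ M₂ := fun e => hy (e ▸ hy₂)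
  obtain ⟨a, ha₁, ha₂⟩ := SetLike.not_le_iff_exists.1 fun hle => h12 ((h₁.le_iff_eq h₂.1).1 hle).symm
  obtain ⟨M₃, h₃, hab⟩ := key (a * y)
  refine ⟨M₁, M₂, M₃, h₁, h₂, h₃, h12, ?_, ?_⟩
  · rintro rfl
    exact hy ((M₁.mul_mem_cancel_left ha₁).1 hab)
  · rintro rfl
    exact ha₂ ((M₂.mul_mem_cancel_right hy₂).1 hab)

end Finite

/-! ### Nilpotent groups, and non-normal Sylow subgroups -/

section Structure

variable {G : Type*} [Group G]

/-- The six are ⊥, the centre, three maximal subgroups and ⊤. -/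
theorem exists_six_normal_subgroups [Finite G] [Group.IsNilpotent G]
    (h : ¬ ∀ a b : G, a * b = b * a) :
    ∃ S : Set (Subgroup G), S.ncard = 6 ∧ ∀ H ∈ S, H.Normal := by
  classical
  have hcyc : ¬ IsCyclic G := fun _ => h mul_comm'
  have : Nontrivial G := by
    by_contra hc
    rw [not_nontrivial_iff_subsingleton] at hc
    exact h fun a b => Subsingleton.elim _ _
  obtain ⟨M₁, M₂, M₃, h₁, h₂, h₃, h12, h13, h23⟩ := exists_three_coatoms hcyc
  have hZtop : center G ≠ ⊤ := fun hZ => h fun a b =>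
    (mem_center_iff.1 (hZ ▸ mem_top b : b ∈ center G) a)
  have hZbot : center G ≠ ⊥ := Group.IsNilpotent.center_ne_bot G
  -- If the centre were maximal, the centralizer of an x outside it would be strictly larger, hence
  -- all of G, making x central.
  have hZ : ∀ M : Subgroup G, IsCoatom M → M ≠ center G := by
    rintro _ hM rfl
    obtain ⟨x, hx⟩ : ∃ x, x ∉ center G := by
      by_contra! hc
      exact hZtop (eq_top_iff.2 fun x _ => hc x)
    have : centralizer {x} = ⊤ := by
      refine hM.2 _ (lt_of_le_of_ne (center_le_centralizer _) fun e => hx ?_)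
      rw [e]
      exact mem_centralizer_singleton_iff.2 rfl
    refine hx (mem_center_iff.2 fun g => ?_)
    exact (mem_centralizer_singleton_iff.1 (this ▸ mem_top g))
  have hbot : ∀ M : Subgroup G, IsCoatom M → M ≠ ⊥ := by
    rintro _ hM rfl
    exact hZtop (hM.2 _ (bot_lt_iff_ne_bot.2 hZbot))
  have hnorm : ∀ M : Subgroup G, IsCoatom M → M.Normal := fun M hM =>
    NormalizerCondition.normal_of_coatom M Group.normalizerCondition_of_isNilpotent hM
  refine ⟨(({⊥, center G, M₁, M₂, M₃, ⊤} : Finset (Subgroup G)) : Set (Subgroup G)), ?_, ?_⟩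
  · rw [Set.ncard_coe_finset]
    have := hZ _ h₁; have := hZ _ h₂; have := hZ _ h₃
    have := hbot _ h₁; have := hbot _ h₂; have := hbot _ h₃
    have := h₁.1; have := h₂.1; have := h₃.1
    have hbt : (⊥ : Subgroup G) ≠ ⊤ := bot_ne_top
    simp only [ne_comm (a := M₁) (b := ⊥), ne_comm (a := M₂) (b := ⊥), ne_comm (a := M₃) (b := ⊥),
      ne_comm (a := M₁) (b := center G), ne_comm (a := M₂) (b := center G),
      ne_comm (a := M₃) (b := center G), ne_comm (a := center G) (b := ⊥)] at *
    repeat rw [Finset.card_insert_of_notMem (by simp [*])]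
    simp
  · intro H hH
    simp only [Finset.coe_insert, Finset.coe_singleton, Set.mem_insert_iff,
      Set.mem_singleton_iff] at hH
    rcases hH with rfl | rfl | rfl | rfl | rfl | rfl
    · infer_instance
    · infer_instance
    · exact hnorm _ h₁
    · exact hnorm _ h₂
    · exact hnorm _ h₃
    · infer_instance

theorem comm_of_isNilpotent_of_normalizerDefect_le [Finite G] [Group.IsNilpotent G]
    (hf : normalizerDefect G ≤ 4) : ∀ a b : G, a * b = b * a := by
  by_contra h
  obtain ⟨S, hS, hn⟩ := exists_six_normal_subgroups h
  have := ncard_le_ncard_add_normalizerDefect S {⊤} fun H hH => normalizer_eq_top_iff.2 (hn H hH)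
  rw [hS, Set.ncard_singleton] at this
  omega

theorem eq_or_eq_top_of_le_of_index_prime {K H : Subgroup G} (hK : K.index.Prime) (hH : K ≤ H) :
    H = K ∨ H = ⊤ := by
  rcases (Nat.dvd_prime hK).1 (index_dvd_of_le hH) with h1 | h1
  · exact Or.inr (index_eq_one.1 h1)
  · left
    have h2 := relIndex_mul_index hH
    rw [h1] at h2
    have h3 : K.relIndex H = 1 := by simpa [hK.ne_zero] using h2
    exact le_antisymm (relIndex_eq_one.1 h3) hH

/-- A subgroup normal in K has normalizer K or G, as K has prime index. Six of these together with ⊤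
would be seven subgroups sharing two normalizers. -/
theorem comm_of_isNilpotent_of_index_prime [Finite G] (hf : normalizerDefect G ≤ 4)
    (K : Subgroup G) [K.Normal] [Group.IsNilpotent K] (hK : K.index.Prime) :
    ∀ a b : K, a * b = b * a := by
  by_contra h
  obtain ⟨S, hS, hn⟩ := exists_six_normal_subgroups h
  have hKtop : K ≠ ⊤ := fun e => hK.ne_one (index_eq_one.2 e)
  have := ncard_le_ncard_add_normalizerDefect (insert ⊤ (Subgroup.map K.subtype '' S)) {K, ⊤} (by
    rintro H (rfl | ⟨H, hH, rfl⟩)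
    · right; exact normalizer_eq_top_iff.2 inferInstance
    · apply eq_or_eq_top_of_le_of_index_prime hK
      have h1 := Subgroup.le_normalizer_map (H := H) K.subtype
      rw [normalizer_eq_top_iff.2 (hn H hH), ← MonoidHom.range_eq_map, range_subtype] at h1
      exact h1)
  rw [Set.ncard_insert_of_notMem, Set.ncard_image_of_injective _
    (Subgroup.map_injective K.subtype_injective), hS, Set.ncard_pair hKtop] at this
  · omega
  · rintro ⟨H, -, hH⟩
    exact hKtop (top_le_iff.1 (hH ▸ map_subtype_le H))

variable {p : ℕ} [Fact p.Prime]

/-- Frattini argument: for g normalizing M, both P and its conjugate by g are Sylow in M, hence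
conjugate by some m in M, and m⁻¹g lies in N(P) ≤ M. -/
theorem normalizer_eq_self_of_sylow_normalizer_le [Finite G] (P : Sylow p G) {M : Subgroup G}
    (h : normalizer (P : Set G) ≤ M) : normalizer (M : Set G) = M := by
  refine le_antisymm (fun g hg => ?_) le_normalizer
  have hPM : (P : Subgroup G) ≤ M := le_normalizer.trans h
  have hgP : ((g • P : Sylow p G) : Subgroup G) ≤ M := by
    rw [Sylow.coe_subgroup_smul]
    have := mem_normalizer_iff_map_conj_eq.1 hg
    rw [← this]
    exact Subgroup.map_mono hPM
  obtain ⟨m, hm⟩ := MulAction.exists_smul_eq M (P.subtype hPM) ((g • P).subtype hgP)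
  rw [Sylow.smul_subtype hPM] at hm
  have h2 : (m : G) • P = g • P := Sylow.subtype_injective hm
  have h3 : (m : G)⁻¹ * g ∈ normalizer (P : Set G) := by
    rw [← Sylow.smul_eq_iff_mem_normalizer, mul_smul, ← h2, inv_smul_smul]
  simpa using M.mul_mem m.2 (h h3)

theorem Sylow.normalizer_eq_self_of_normalizerDefect_le [Finite G] (hf : normalizerDefect G ≤ 4)
    (P : Sylow p G) (hP : ¬ (P : Subgroup G).Normal) : normalizer (P : Set G) = P :=
  (normal_or_normalizer_eq_self hf P P.normalizer_normalizer).resolve_left hP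

theorem Sylow.normal_of_lt_of_le_normalizer [Finite G] (hf : normalizerDefect G ≤ 4)
    (P : Sylow p G) (hP : ¬ (P : Subgroup G).Normal) {Q : Subgroup G} (hQ : Q < P)
    (hN : (P : Subgroup G) ≤ normalizer (Q : Set G)) : Q.Normal := by
  have h1 := P.normalizer_eq_self_of_normalizerDefect_le hf hP
  refine (normal_or_normalizer_eq_self hf Q
    (normalizer_eq_self_of_sylow_normalizer_le P (h1.trans_le hN))).resolve_right fun h => ?_
  exact hQ.not_ge (hN.trans_eq h)

/-- Maximal subgroups of P are normal in P, hence normal in G. Two distinct ones would generate P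
and make it normal. -/
theorem Sylow.isCyclic_of_normalizerDefect_le [Finite G] (hf : normalizerDefect G ≤ 4)
    (P : Sylow p G) (hP : ¬ (P : Subgroup G).Normal) : IsCyclic P := by
  by_contra hc
  obtain ⟨M₁, M₂, -, h₁, h₂, -, h12, -⟩ := exists_three_coatoms hc
  have : Group.IsNilpotent P := P.2.isNilpotent
  have key : ∀ M : Subgroup P, IsCoatom M → (M.map (P : Subgroup G).subtype).Normal := fun M hM => by
    have hn := NormalizerCondition.normal_of_coatom M Group.normalizerCondition_of_isNilpotent hM
    refine P.normal_of_lt_of_le_normalizer hf hP (lt_of_le_of_ne (map_subtype_le M) fun e => ?_) ?_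
    · apply hM.1
      apply Subgroup.map_injective (P : Subgroup G).subtype_injective
      rw [e, ← MonoidHom.range_eq_map, range_subtype]
    · have h1 := Subgroup.le_normalizer_map (H := M) (P : Subgroup G).subtype
      rw [normalizer_eq_top_iff.2 hn, ← MonoidHom.range_eq_map, range_subtype] at h1
      exact h1
  have h3 := key _ h₁
  have h4 := key _ h₂
  apply hP
  have h5 : M₁ ⊔ M₂ = ⊤ := h₁.2 _ (lt_of_le_of_ne le_sup_left fun e =>
    h12 ((h₂.le_iff_eq h₁.1).1 (e ▸ le_sup_right)))
  have h6 : (P : Subgroup G) = M₁.map (P : Subgroup G).subtype ⊔ M₂.map (P : Subgroup G).subtype := by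
    rw [← Subgroup.map_sup, h5, ← MonoidHom.range_eq_map, range_subtype]
  rw [h6]
  exact Subgroup.sup_normal _ _

theorem Sylow.normal_of_lt [Finite G] (hf : normalizerDefect G ≤ 4)
    (P : Sylow p G) (hP : ¬ (P : Subgroup G).Normal) {Q : Subgroup G} (hQ : Q < P) : Q.Normal := by
  have hc := P.isCyclic_of_normalizerDefect_le hf hP
  refine P.normal_of_lt_of_le_normalizer hf hP hQ fun x hx => ?_
  rw [mem_normalizer_iff]
  have : ∀ y ∈ (P : Subgroup G), x * y * x⁻¹ = y := fun y hy => by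
    have := mul_comm' (⟨x, hx⟩ : P) ⟨y, hy⟩
    rw [mul_inv_eq_iff_eq_mul]
    exact congrArg Subtype.val this
  intro y
  refine ⟨fun hy => by rwa [this y (hQ.le hy)], fun hy => ?_⟩
  have hy' : y ∈ (P : Subgroup G) := by
    have h1 := mul_mem (mul_mem (inv_mem hx) (hQ.le hy)) hx
    simpa [mul_assoc] using h1
  rwa [this y hy'] at hy

end Structure

/-! ### Normal complements, and Sylow subgroups of non-prime order -/

section Complement

variable {G : Type*} [Group G]

theorem Subgroup.le_of_coprime_card_index (K H : Subgroup G) [K.Normal]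
    (h : (Nat.card H).Coprime K.index) : H ≤ K :=
  relIndex_eq_one.1 (Nat.eq_one_of_dvd_coprimes h (relIndex_dvd_card K H)
    (relIndex_dvd_index_of_normal K H))

/-- P is abelian and self-normalizing, so Burnside's transfer theorem provides K. A Sylow subgroup R
of K that is not normal in G would be self-normalizing, and Frattini's G = N(R)K would collapse to
K. -/
theorem Sylow.exists_isNilpotent_complement [Finite G] {p : ℕ} [Fact p.Prime]
    (hf : normalizerDefect G ≤ 4) (P : Sylow p G) (hP : ¬ (P : Subgroup G).Normal) :
    ∃ K : Subgroup G, K.Normal ∧ K.IsComplement' P ∧ Group.IsNilpotent K := by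
  have hc := P.isCyclic_of_normalizerDefect_le hf hP
  have hN := P.normalizer_eq_self_of_normalizerDefect_le hf hP
  have hle : normalizer (P : Set G) ≤ centralizer (P : Set G) := by
    intro x hx y hy
    have hx' : x ∈ (P : Subgroup G) := hN ▸ hx
    exact congrArg Subtype.val (mul_comm' (⟨y, hy⟩ : P) ⟨x, hx'⟩)
  set K := (MonoidHom.transferSylow P hle).ker
  have hcompl : K.IsComplement' P := MonoidHom.ker_transferSylow_isComplement' P hle
  have hp : ¬ p ∣ Nat.card K := MonoidHom.not_dvd_card_ker_transferSylow P hle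
  have hKtop : K ≠ ⊤ := fun e => hP (by
    have h1 := hcompl.disjoint.eq_bot
    rw [e, top_inf_eq] at h1
    rw [h1]
    infer_instance)
  refine ⟨K, inferInstance, hcompl, (Group.isNilpotent_of_finite_tfae.out 0 3).2 ?_⟩
  intro r hr R'
  by_cases hrp : r = p
  · subst hrp
    have h1 : (R' : Subgroup K) = ⊥ := card_eq_one.1 (R'.2.card_eq_or_dvd.resolve_right
      fun h => hp (h.trans (card_subgroup_dvd_card _)))
    rw [h1]
    infer_instance
  · obtain ⟨R, hR⟩ := R'.exists_comap_subtype_eq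
    have hRn : (R : Subgroup G).Normal := by
      by_contra hRn
      have h1 := R.normalizer_eq_self_of_normalizerDefect_le hf hRn
      have h2 : (R : Subgroup G) ≤ K := by
        apply K.le_of_coprime_card_index
        obtain ⟨a, ha⟩ := IsPGroup.iff_card.1 R.2
        obtain ⟨b, hb⟩ := IsPGroup.iff_card.1 P.2
        rw [hcompl.symm.index_eq_card, ha, hb]
        exact Nat.Coprime.pow _ _ ((Nat.coprime_primes Fact.out Fact.out).2 hrp)
      have h3 := R.normalizer_sup_eq_top' h2
      rw [h1, sup_eq_right.2 h2] at h3
      exact hKtop h3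
    rw [← hR]
    exact hRn.comap _

theorem Subgroup.isCyclic_sylow_of_isCyclic [Finite G] (K : Subgroup G) [K.Normal] [IsCyclic K]
    {p : ℕ} [Fact p.Prime] (P : Sylow p G) [IsCyclic P] (h : K.IsComplement' P)
    {r : ℕ} (hr : r.Prime) (R : Sylow r G) : IsCyclic R := by
  have : Fact r.Prime := ⟨hr⟩
  by_cases hrp : r = p
  · subst hrp
    exact (P.equiv R).isCyclic.1 inferInstance
  · have h2 : (R : Subgroup G) ≤ K := by
      apply K.le_of_coprime_card_index
      obtain ⟨a, ha⟩ := IsPGroup.iff_card.1 R.2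
      obtain ⟨b, hb⟩ := IsPGroup.iff_card.1 P.2
      rw [h.symm.index_eq_card, ha, hb]
      exact Nat.Coprime.pow _ _ ((Nat.coprime_primes Fact.out Fact.out).2 hrp)
    exact isCyclic_of_injective (Subgroup.inclusion h2) (Subgroup.inclusion_injective h2)

theorem Subgroup.sup_inf_eq_of_le_of_disjoint {K Q H : Subgroup G} [Q.Normal] (hH : H ≤ K)
    (h : Q ⊓ K = ⊥) : (H ⊔ Q) ⊓ K = H := by
  apply SetLike.coe_injective
  rw [Subgroup.coe_inf, Subgroup.mul_normal, ← Subgroup.mul_inf_assoc _ _ _ hH, h]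
  simp

/-- A subgroup Q of order p in P is proper, hence normal in G. The normal subgroups ⊥, Q, K, KQ, ⊤
use up the whole defect, which leaves K no proper nontrivial subgroup. -/
theorem isZMGroup_of_card_sylow_ne [Finite G] {p : ℕ} [Fact p.Prime]
    (hf : normalizerDefect G ≤ 4) (P : Sylow p G) (hP : ¬ (P : Subgroup G).Normal)
    (hcard : Nat.card P ≠ p) : normalizerDefect G = 4 ∧ IsZMGroup G := by
  classical
  obtain ⟨K, hKn, hcompl, -⟩ := P.exists_isNilpotent_complement hf hP
  have hPbot : (P : Subgroup G) ≠ ⊥ := fun h => hP (by rw [h]; infer_instance)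
  have hPtop : (P : Subgroup G) ≠ ⊤ := fun h => hP (by rw [h]; infer_instance)
  have hcyc := P.isCyclic_of_normalizerDefect_le hf hP
  obtain ⟨Q, hQP, hQbot⟩ : ∃ Q : Subgroup G, Q < P ∧ Q ≠ ⊥ := by
    have hdvd : p ∣ Nat.card P := P.2.card_eq_or_dvd.resolve_left fun h => hPbot (card_eq_one.1 h)
    obtain ⟨x, hx⟩ := exists_prime_orderOf_dvd_card' p hdvd
    have hx' : orderOf (x : G) = p := by rw [Subgroup.orderOf_coe, hx]
    refine ⟨zpowers (x : G), lt_of_le_of_ne (by simp) fun e => hcard ?_, fun e => ?_⟩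
    · exact (congrArg (fun H : Subgroup G => Nat.card H) e).symm.trans
        ((Nat.card_zpowers _).trans hx')
    · rw [zpowers_eq_bot] at e
      rw [e, orderOf_one] at hx'
      exact (Fact.out : p.Prime).ne_one hx'.symm
  have hQn : Q.Normal := P.normal_of_lt hf hP hQP
  have hKP : K ⊓ P = ⊥ := hcompl.disjoint.eq_bot
  have hQK : Q ⊓ K = ⊥ := by
    rw [eq_bot_iff, ← hKP, inf_comm]
    exact inf_le_inf_left _ hQP.le
  have hKbot : K ≠ ⊥ := fun h => hPtop (by
    have := hcompl.sup_eq_top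
    rwa [h, bot_sup_eq] at this)
  have hKQ : K ≠ Q := fun h => hKbot (by rw [← h, inf_idem] at hQK; exact hQK)
  have hKKQ : K ≠ K ⊔ Q := fun h => hQbot (by
    have : Q ≤ K := h ▸ le_sup_right
    rwa [inf_eq_left.2 this] at hQK)
  have hQKQ : Q ≠ K ⊔ Q := fun h => hKbot (by
    have : K ≤ Q := h ▸ le_sup_left
    rwa [inf_eq_right.2 this] at hQK)
  have hKQtop : K ⊔ Q ≠ ⊤ := fun h => by
    have h1 := Subgroup.sup_inf_eq_of_le_of_disjoint (K := (P : Subgroup G)) hQP.le hKP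
    rw [sup_comm, h, top_inf_eq] at h1
    exact hQP.ne h1.symm
  have hKtop : K ≠ ⊤ := fun h => hKQtop (by simp [h])
  have hQtop : Q ≠ ⊤ := fun h => hKQtop (by simp [h])
  have hbt : (⊥ : Subgroup G) ≠ ⊤ := fun h => hKbot (eq_bot_iff.2 (h ▸ le_top))
  let S : Finset (Subgroup G) := {⊥, Q, K, K ⊔ Q, ⊤}
  have hScard : S.card = 5 := by
    have h1 : K ⊔ Q ≠ ⊥ := fun h => hKbot (sup_eq_bot_iff.1 h).1
    have h2 := ne_comm.1 hKQ
    have h3 := ne_comm.1 hQbot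
    have h4 := ne_comm.1 hKbot
    have h5 := ne_comm.1 h1
    simp only [S]
    rw [Finset.card_insert_of_notMem, Finset.card_insert_of_notMem, Finset.card_insert_of_notMem,
      Finset.card_insert_of_notMem, Finset.card_singleton] <;>
    simp only [Finset.mem_insert, Finset.mem_singleton, not_or]
    · exact hKQtop
    · exact ⟨hKKQ, hKtop⟩
    · exact ⟨h2, hQKQ, hQtop⟩
    · exact ⟨h3, h4, h5, hbt⟩
  have hSn : ∀ H ∈ S, H.Normal := by
    intro H hH
    simp only [S, Finset.mem_insert, Finset.mem_singleton] at hH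
    rcases hH with rfl | rfl | rfl | rfl | rfl <;> infer_instance
  have hf4 : normalizerDefect G = 4 := by
    have := ncard_le_ncard_add_normalizerDefect (S : Set (Subgroup G)) {⊤}
      fun H hH => normalizer_eq_top_iff.2 (hSn H hH)
    rw [Set.ncard_coe_finset, hScard, Set.ncard_singleton] at this
    omega
  refine ⟨hf4, ‹_›, fun hcomm => hP ⟨fun x hx g => ?_⟩, ?_⟩
  · rw [hcomm g x, mul_inv_cancel_right]
    exact hx
  -- Since HQ ∩ K = H, the subgroups H and HQ have the same normalizer. If H were not normal, they
  -- and the five normal subgroups would be seven subgroups with two normalizers.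
  have hnormal : ∀ H : Subgroup G, H ≤ K → H.Normal := fun H hH => by
    by_contra hHn
    have hHQK := Subgroup.sup_inf_eq_of_le_of_disjoint hH hQK
    have hN : normalizer ((H ⊔ Q : Subgroup G) : Set G) = normalizer (H : Set G) := by
      apply le_antisymm
      · have := inf_normalizer_le_normalizer_inf (H := H ⊔ Q) (K := K)
        rwa [hHQK, normalizer_eq_top_iff.2 hKn, inf_top_eq] at this
      · have := H.normalizer_inf_normalizer_le_normalizer_sup Q
        rwa [normalizer_eq_top_iff.2 hQn, inf_top_eq] at this
    have hHQn : ¬ (H ⊔ Q).Normal := fun h => hHn (by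
      rw [← normalizer_eq_top_iff, ← hN]
      exact normalizer_eq_top_iff.2 h)
    have hne : H ≠ H ⊔ Q := fun e => hQbot (by
      have : Q ≤ K := (e ▸ le_sup_right : Q ≤ H).trans hH
      rwa [inf_eq_left.2 this] at hQK)
    have hcard : (insert H (insert (H ⊔ Q) S)).card = 7 := by
      rw [Finset.card_insert_of_notMem, Finset.card_insert_of_notMem, hScard]
      · exact fun h => hHQn (hSn _ h)
      · rw [Finset.mem_insert, not_or]
        exact ⟨hne, fun h => hHn (hSn _ h)⟩
    have := ncard_le_ncard_add_normalizerDefect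
      ((insert H (insert (H ⊔ Q) S) : Finset (Subgroup G)) : Set (Subgroup G))
      {normalizer (H : Set G), ⊤} (by
        intro H' hH'
        simp only [Finset.coe_insert, Set.mem_insert_iff] at hH'
        rcases hH' with rfl | rfl | h
        · exact Or.inl rfl
        · exact Or.inl hN
        · exact Or.inr (normalizer_eq_top_iff.2 (hSn _ h)))
    rw [Set.ncard_coe_finset, hcard] at this
    have h2 := Set.ncard_insert_le (normalizer (H : Set G)) {⊤}
    rw [Set.ncard_singleton] at h2
    omega
  -- Any other H would be a sixth normal subgroup.
  have hsimple : ∀ H : Subgroup G, H ≤ K → H = ⊥ ∨ H = K := fun H hH => by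
    by_contra! hcon
    have hHS : H ∉ S := by
      simp only [S, Finset.mem_insert, Finset.mem_singleton, not_or]
      refine ⟨hcon.1, ?_, hcon.2, ?_, fun h => hKtop (top_le_iff.1 (h ▸ hH))⟩
      · rintro rfl
        exact hQbot (by rwa [inf_eq_left.2 hH] at hQK)
      · rintro rfl
        exact hKKQ (le_antisymm le_sup_left hH)
    have := ncard_le_ncard_add_normalizerDefect
      ((insert H S : Finset (Subgroup G)) : Set (Subgroup G)) {⊤} (by
        intro H' hH'
        simp only [Finset.coe_insert, Set.mem_insert_iff] at hH'
        rcases hH' with rfl | h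
        · exact normalizer_eq_top_iff.2 (hnormal _ hH)
        · exact normalizer_eq_top_iff.2 (hSn _ h))
    rw [Set.ncard_coe_finset, Finset.card_insert_of_notMem hHS, hScard, Set.ncard_singleton] at this
    omega
  have hKcyc : IsCyclic K := by
    obtain ⟨x, hxK, hx⟩ := K.bot_or_exists_ne_one.resolve_left hKbot
    have h1 : zpowers x = K := (hsimple _ (by simpa using hxK)).resolve_left
      (by simpa using hx)
    rw [← h1]
    infer_instance
  exact fun r hr R => K.isCyclic_sylow_of_isCyclic P hcompl hr R

end Complement

/-! ### The defect when a self-normalizing Sylow subgroup of prime order has a normal complement -/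

section Frobenius

variable {G : Type*} [Group G]

theorem Subgroup.normalizer_map_conj (H : Subgroup G) (g : G) :
    normalizer ((H.map (MulAut.conj g).toMonoidHom : Subgroup G) : Set G) =
      (normalizer (H : Set G)).map (MulAut.conj g).toMonoidHom :=
  (Subgroup.map_equiv_normalizer_eq H (MulAut.conj g)).symm

variable {p : ℕ} [Fact p.Prime]

theorem Sylow.normalizer_eq_self_of_normalizer_eq_self [Finite G] {P : Sylow p G}
    (hN : normalizer (P : Set G) = P) (P' : Sylow p G) : normalizer (P' : Set G) = P' := by
  obtain ⟨g, rfl⟩ := MulAction.exists_smul_eq G P P'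
  have h1 : ((g • P : Sylow p G) : Subgroup G) =
      (P : Subgroup G).map (MulAut.conj g).toMonoidHom := rfl
  have h2 := Subgroup.normalizer_map_conj (P : Subgroup G) g
  rw [← h1, Sylow.coe_coe, Sylow.coe_coe P, hN, ← h1] at h2
  exact h2

/-- The order of H is divisible by p, so H contains a Sylow p-subgroup, which is its own normalizer.
-/
theorem Sylow.normalizer_eq_self_of_not_le [Finite G] {K : Subgroup G} [K.Normal] {P : Sylow p G}
    (hKp : K.index = p) (hPp : Nat.card P = p) (hN : normalizer (P : Set G) = P) {H : Subgroup G}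
    (hH : ¬ H ≤ K) : normalizer (H : Set G) = H := by
  have hdvd : p ∣ Nat.card H := by
    have h1 : K.relIndex H ∣ p := hKp ▸ relIndex_dvd_index_of_normal K H
    rcases (Nat.dvd_prime Fact.out).1 h1 with h | h
    · exact (hH (relIndex_eq_one.1 h)).elim
    · exact h ▸ relIndex_dvd_card K H
  obtain ⟨x, hx⟩ := exists_prime_orderOf_dvd_card' p hdvd
  have hcard : Nat.card (zpowers (x : G)) = p ^ (Nat.card G).factorization p := by
    rw [Nat.card_zpowers, Subgroup.orderOf_coe, hx, ← P.card_eq_multiplicity, hPp]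
  have h1 := Sylow.normalizer_eq_self_of_normalizer_eq_self hN (Sylow.ofCard _ hcard)
  refine normalizer_eq_self_of_sylow_normalizer_le (Sylow.ofCard _ hcard) (h1.trans_le ?_)
  rw [Sylow.coe_ofCard]
  simp

theorem Subgroup.le_normalizer_of_comm {K H : Subgroup G} (hK : ∀ a b : K, a * b = b * a)
    (hH : H ≤ K) : K ≤ normalizer (H : Set G) := by
  intro x hx
  have key : ∀ y ∈ K, x * y * x⁻¹ = y := fun y hy => by
    rw [mul_inv_eq_iff_eq_mul]
    exact congrArg Subtype.val (hK ⟨x, hx⟩ ⟨y, hy⟩)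
  rw [mem_normalizer_iff]
  refine fun y => ⟨fun hy => by rwa [key y (hH hy)], fun hy => ?_⟩
  have hy' : y ∈ K := by
    have h1 := mul_mem (mul_mem (inv_mem hx) (hH hy)) hx
    simpa [mul_assoc] using h1
  rwa [key y hy'] at hy

theorem card_subgroup_eq_ncard_add [Finite G] (K : Subgroup G) :
    Nat.card (Subgroup G) = {H : Subgroup G | ¬ H ≤ K}.ncard + Nat.card (Subgroup K) := by
  rw [Nat.card_congr (MapSubtype.orderIso K).toEquiv,
    ← Set.ncard_add_ncard_compl {H : Subgroup G | ¬ H ≤ K}]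
  congr 1
  rw [← Nat.card_coe_set_eq]
  congr 2
  ext H
  simp only [Set.mem_compl_iff, Set.mem_ofPred_eq, not_not]
  rfl

theorem normalizerDefect_of_forall_normal [Finite G] {K : Subgroup G} [K.Normal] {P : Sylow p G}
    (hKp : K.index = p) (hPp : Nat.card P = p) (hN : normalizer (P : Set G) = P)
    (h : ∀ H ≤ K, H.Normal) : normalizerDefect G = Nat.card (Subgroup K) := by
  have hset : normalizerSet G = {H : Subgroup G | ¬ H ≤ K} := by
    ext L
    rw [normalizerSet_eq_range]
    constructor
    · rintro ⟨H, rfl⟩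
      by_cases hH : H ≤ K
      · change ¬ normalizer (H : Set G) ≤ K
        rw [normalizer_eq_top_iff.2 (h H hH), top_le_iff]
        rintro rfl
        exact (Fact.out : p.Prime).ne_one (hKp ▸ index_top)
      · simpa [Sylow.normalizer_eq_self_of_not_le hKp hPp hN hH] using hH
    · exact fun hL => ⟨L, Sylow.normalizer_eq_self_of_not_le hKp hPp hN hL⟩
  unfold normalizerDefect
  rw [hset, card_subgroup_eq_ncard_add K]
  omega

/-- Non-normal subgroups of the abelian group K have normalizer exactly K. So K is a value in
addition to the subgroups not inside K, which accounts for the `+ 1`. -/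
theorem normalizerDefect_of_exists_not_normal [Finite G] {K : Subgroup G} [K.Normal]
    {P : Sylow p G} (hKp : K.index = p) (hPp : Nat.card P = p)
    (hN : normalizer (P : Set G) = P) (hK : ∀ a b : K, a * b = b * a)
    (h : ∃ H ≤ K, ¬ H.Normal) : normalizerDefect G + 1 = Nat.card (Subgroup K) := by
  have hKtop : ¬ (⊤ : Subgroup G) ≤ K := fun e => by
    rw [top_le_iff.1 e, index_top] at hKp
    exact (Fact.out : p.Prime).ne_one hKp.symm
  have hcase : ∀ H ≤ K, ¬ H.Normal → normalizer (H : Set G) = K := fun H hH hHn =>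
    (eq_or_eq_top_of_le_of_index_prime (hKp ▸ Fact.out)
      (Subgroup.le_normalizer_of_comm hK hH)).resolve_right fun e => hHn (normalizer_eq_top_iff.1 e)
  have hset : normalizerSet G = insert K {H : Subgroup G | ¬ H ≤ K} := by
    ext L
    rw [normalizerSet_eq_range]
    constructor
    · rintro ⟨H, rfl⟩
      by_cases hH : H ≤ K
      · by_cases hHn : H.Normal
        · right
          simpa [normalizer_eq_top_iff.2 hHn] using hKtop
        · exact Or.inl (hcase H hH hHn)
      · right
        simpa [Sylow.normalizer_eq_self_of_not_le hKp hPp hN hH] using hH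
    · rintro (rfl | hL)
      · obtain ⟨H, hH, hHn⟩ := h
        exact ⟨H, hcase H hH hHn⟩
      · exact ⟨L, Sylow.normalizer_eq_self_of_not_le hKp hPp hN hL⟩
  have h1 := ncard_add_normalizerDefect G
  rw [hset, card_subgroup_eq_ncard_add K, Set.ncard_insert_of_notMem (by simp)] at h1
  omega

end Frobenius

/-! ### Structure of groups of defect at most four -/

section Dichotomy

variable {G : Type*} [Group G] [Finite G]

/-- A finite group of defect at most four is abelian, or a ZM-group of defect four, or a Frobenius
group with abelian kernel and complements of prime order. -/
theorem structure_of_normalizerDefect_le (hf : normalizerDefect G ≤ 4) :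
    (∀ a b : G, a * b = b * a) ∨ (normalizerDefect G = 4 ∧ IsZMGroup G) ∨
      ∃ (p : ℕ) (_ : Fact p.Prime) (K : Subgroup G) (P : Sylow p G), K.Normal ∧
        K.IsComplement' P ∧ (∀ a b : K, a * b = b * a) ∧ Nat.card P = p ∧
        normalizer (P : Set G) = P ∧ ¬ (P : Subgroup G).Normal := by
  by_cases hnil : Group.IsNilpotent G
  · exact Or.inl (comm_of_isNilpotent_of_normalizerDefect_le hf)
  · right
    have hex := mt (Group.isNilpotent_of_finite_tfae (G := G).out 0 3).2 hnil
    push Not at hex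
    obtain ⟨p, hp, P, hP⟩ := hex
    by_cases hcard : Nat.card P = p
    · right
      obtain ⟨K, hKn, hcompl, hKnil⟩ := P.exists_isNilpotent_complement hf hP
      have hidx : K.index.Prime := by
        rw [hcompl.symm.index_eq_card]
        exact hcard.symm ▸ hp.out
      exact ⟨p, hp, K, P, hKn, hcompl, comm_of_isNilpotent_of_index_prime hf K hidx, hcard,
        P.normalizer_eq_self_of_normalizerDefect_le hf hP, hP⟩
    · exact Or.inl (isZMGroup_of_card_sylow_ne hf P hP hcard)

end Dichotomy

/-! ### Counting subgroups of cyclic groups and of the Klein four-group -/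

section Counting

variable {G : Type*} [Group G]

theorem normalizerDefect_add_one_of_comm [Finite G] (h : ∀ a b : G, a * b = b * a) :
    normalizerDefect G + 1 = Nat.card (Subgroup G) := by
  have h1 : normalizerSet G = {⊤} := by
    rw [normalizerSet_eq_range, Set.range_eq_singleton_iff]
    refine fun H => normalizer_eq_top_iff.2 ⟨fun x hx g => ?_⟩
    rwa [h g x, mul_inv_cancel_right]
  have h2 := ncard_add_normalizerDefect G
  rw [h1, Set.ncard_singleton] at h2
  omega

theorem Subgroup.eq_of_card_eq_of_isCyclic [Finite G] [IsCyclic G] {H H' : Subgroup G}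
    (h : Nat.card H = Nat.card H') : H = H' := by
  classical
  have := Fintype.ofFinite G
  have key : ∀ H : Subgroup G, (H : Set G) =
      ((Finset.univ.filter fun x : G => x ^ Nat.card H = 1 : Finset G) : Set G) := fun H => by
    refine Set.eq_of_subset_of_ncard_le ?_ ?_
    · intro x hx
      have := congrArg Subtype.val (pow_card_eq_one' (x := (⟨x, hx⟩ : H)))
      exact Finset.mem_coe.2 (Finset.mem_filter.2 ⟨Finset.mem_univ _, this⟩)
    · rw [Set.ncard_coe_finset]
      exact (IsCyclic.card_pow_eq_one_le Nat.card_pos).trans_eq (Nat.card_coe_set_eq _)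
  apply SetLike.coe_injective
  rw [key H, key H', h]

theorem card_subgroup_of_isCyclic [Finite G] [IsCyclic G] :
    Nat.card (Subgroup G) = (Nat.card G).divisors.card := by
  obtain ⟨g, hg⟩ := isCyclic_iff_exists_zpowers_eq_top.1 (inferInstance : IsCyclic G)
  have hcard : orderOf g = Nat.card G := by rw [← Nat.card_zpowers, hg, card_top]
  rw [← Nat.card_eq_finsetCard]
  refine Nat.card_congr (Equiv.ofBijective (fun H => ⟨Nat.card H, Nat.mem_divisors.2
    ⟨card_subgroup_dvd_card H, Nat.card_pos.ne'⟩⟩) ⟨fun H H' h => ?_, ?_⟩)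
  · exact Subgroup.eq_of_card_eq_of_isCyclic (congrArg Subtype.val h)
  · rintro ⟨d, hd⟩
    obtain ⟨⟨c, hc⟩, h0⟩ := Nat.mem_divisors.1 hd
    refine ⟨zpowers (g ^ c), Subtype.ext ?_⟩
    have hc0 : c ≠ 0 := by rintro rfl; simp_all
    simp only [Nat.card_zpowers]
    rw [orderOf_pow_of_dvd hc0 (by rw [hcard, hc]; exact dvd_mul_left _ _), hcard, hc,
      Nat.mul_div_cancel _ (Nat.pos_of_ne_zero hc0)]

theorem five_le_card_subgroup [Finite G] (h : ¬ IsCyclic G) : 5 ≤ Nat.card (Subgroup G) ∧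
    (Nat.card (Subgroup G) = 5 → ∃ M₁ M₂ M₃ : Subgroup G, IsCoatom M₁ ∧ IsCoatom M₂ ∧ IsCoatom M₃ ∧
      M₁ ≠ M₂ ∧ M₁ ≠ M₃ ∧ M₂ ≠ M₃ ∧
      ∀ H : Subgroup G, H = ⊥ ∨ H = M₁ ∨ H = M₂ ∨ H = M₃ ∨ H = ⊤) := by
  classical
  obtain ⟨M₁, M₂, M₃, h₁, h₂, h₃, h12, h13, h23⟩ := exists_three_coatoms h
  have hb : ∀ M M' : Subgroup G, IsCoatom M → IsCoatom M' → M ≠ M' → ⊥ ≠ M := by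
    rintro _ M' hM hM' hne rfl
    exact hne ((hM.le_iff_eq hM'.1).1 bot_le).symm
  have hb1 := hb _ _ h₁ h₂ h12
  have hb2 := hb _ _ h₂ h₁ h12.symm
  have hb3 := hb _ _ h₃ h₁ h13.symm
  have hbt : (⊥ : Subgroup G) ≠ ⊤ := fun e => h₁.1 (top_le_iff.1 (e ▸ bot_le))
  have hcard : (({⊥, M₁, M₂, M₃, ⊤} : Finset (Subgroup G)) : Set (Subgroup G)).ncard = 5 := by
    rw [Set.ncard_coe_finset, Finset.card_insert_of_notMem, Finset.card_insert_of_notMem,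
      Finset.card_insert_of_notMem, Finset.card_insert_of_notMem, Finset.card_singleton] <;>
    simp only [Finset.mem_insert, Finset.mem_singleton, not_or]
    · exact h₃.1
    · exact ⟨h23, h₂.1⟩
    · exact ⟨h12, h13, h₁.1⟩
    · exact ⟨hb1, hb2, hb3, hbt⟩
  constructor
  · rw [← hcard, ← Set.ncard_univ]
    exact Set.ncard_le_ncard (Set.subset_univ _)
  · intro h5
    refine ⟨M₁, M₂, M₃, h₁, h₂, h₃, h12, h13, h23, fun H => ?_⟩
    have huniv := Set.eq_of_subset_of_ncard_le (Set.subset_univ _)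
      (((Set.ncard_univ _).trans h5).trans hcard.symm).le
    have := huniv.symm ▸ Set.mem_univ H
    simpa using this

/-- The three maximal subgroups cover G and meet pairwise trivially, since each is generated by any
of its nontrivial elements. -/
theorem isKleinFour_of_card_subgroup_eq_five [Finite G] (hcomm : ∀ a b : G, a * b = b * a)
    (h : ¬ IsCyclic G) (h5 : Nat.card (Subgroup G) = 5) : IsKleinFour G := by
  obtain ⟨M₁, M₂, M₃, h₁, h₂, h₃, h12, h13, h23, hall⟩ := (five_le_card_subgroup h).2 h5
  have hz : ∀ x : G, x ≠ 1 → zpowers x = M₁ ∨ zpowers x = M₂ ∨ zpowers x = M₃ := fun x hx => by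
    rcases hall (zpowers x) with e | e | e | e | e
    · exact (hx (zpowers_eq_bot.1 e)).elim
    · exact Or.inl e
    · exact Or.inr (Or.inl e)
    · exact Or.inr (Or.inr e)
    · exact (h (isCyclic_iff_exists_zpowers_eq_top.2 ⟨x, e⟩)).elim
  have hz' : ∀ M : Subgroup G, IsCoatom M → ∀ x ∈ M, x ≠ 1 → zpowers x = M := fun M hM x hx h1 => by
    have hle : zpowers x ≤ M := by simpa using hx
    have hco : IsCoatom (zpowers x) := by
      rcases hz x h1 with e | e | e <;> rw [e] <;> assumption
    exact ((hco.le_iff_eq hM.1).1 hle).symm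
  have hdisj : ∀ M M' : Subgroup G, IsCoatom M → IsCoatom M' → M ≠ M' → ∀ x ∈ M, x ∈ M' → x = 1 :=
    fun M M' hM hM' hne x hx hx' => by
      by_contra h1
      exact hne ((hz' M hM x hx h1).symm.trans (hz' M' hM' x hx' h1))
  have hmem : ∀ x : G, x ∈ M₁ ∨ x ∈ M₂ ∨ x ∈ M₃ := fun x => by
    by_cases h1 : x = 1
    · exact Or.inl (h1 ▸ one_mem _)
    · rcases hz x h1 with e | e | e
      · exact Or.inl (e ▸ mem_zpowers x)
      · exact Or.inr (Or.inl (e ▸ mem_zpowers x))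
      · exact Or.inr (Or.inr (e ▸ mem_zpowers x))
  -- For b in M' outside M, both ab and a⁻¹b are forced into M''. Hence (ab)(a⁻¹b)⁻¹ = a² lies in M
  -- ∩ M'' = 1.
  have hsq : ∀ M M' M'' : Subgroup G, IsCoatom M → IsCoatom M' → IsCoatom M'' → M ≠ M' → M ≠ M'' →
      M' ≠ M'' → (∀ x, x ∈ M ∨ x ∈ M' ∨ x ∈ M'') → ∀ a ∈ M, a * a = 1 := by
    intro M M' M'' hM hM' hM'' h1 h2 h3 hU a ha
    by_cases ha1 : a = 1
    · simp [ha1]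
    obtain ⟨b, hbM', hbM⟩ := SetLike.not_le_iff_exists.1 fun hle =>
      h1 ((hM'.le_iff_eq hM.1).1 hle)
    have haM' : a ∉ M' := fun h => ha1 (hdisj M M' hM hM' h1 a ha h)
    have key : ∀ c ∈ M, c ∉ M' → c * b ∈ M'' := fun c hc hc' => by
      rcases hU (c * b) with h | h | h
      · exact (hbM ((M.mul_mem_cancel_left hc).1 h)).elim
      · exact (hc' ((M'.mul_mem_cancel_right hbM').1 h)).elim
      · exact h
    have h4 := mul_mem (key a ha haM') (inv_mem (key a⁻¹ (inv_mem ha) (by simpa using haM')))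
    refine hdisj M M'' hM hM'' h2 _ (mul_mem ha ha) ?_
    simpa using h4
  have hsq1 := hsq M₁ M₂ M₃ h₁ h₂ h₃ h12 h13 h23 hmem
  have hsq2 := hsq M₂ M₁ M₃ h₂ h₁ h₃ h12.symm h23 h13 fun x => by have := hmem x; tauto
  have hsq3 := hsq M₃ M₁ M₂ h₃ h₁ h₂ h13.symm h23.symm h12 fun x => by have := hmem x; tauto
  have hexp : ∀ x : G, x ^ 2 = 1 := fun x => by
    rw [pow_two]
    rcases hmem x with h | h | h
    · exact hsq1 x h
    · exact hsq2 x h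
    · exact hsq3 x h
  have hcard2 : ∀ M M' : Subgroup G, IsCoatom M → IsCoatom M' → M ≠ M' → Nat.card M = 2 := by
    intro M M' hM hM' hne
    obtain ⟨x, hx, hx'⟩ := SetLike.not_le_iff_exists.1 fun hle =>
      hne ((hM.le_iff_eq hM'.1).1 hle).symm
    have hx1 : x ≠ 1 := fun e => hx' (e ▸ one_mem _)
    rw [← hz' M hM x hx hx1, Nat.card_zpowers]
    exact orderOf_eq_prime (hexp x) hx1
  have hcompl : M₁.IsComplement' M₂ := by
    refine isComplement'_of_disjoint_and_mul_eq_univ ?_ ?_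
    · rw [disjoint_def]
      exact fun {x} hx hx' => hdisj _ _ h₁ h₂ h12 x hx hx'
    · have hn : M₂.Normal := ⟨fun x hx g => by rwa [hcomm g x, mul_inv_cancel_right]⟩
      rw [← Subgroup.mul_normal, h₁.2 _ (lt_of_le_of_ne le_sup_left fun e =>
        h12 ((h₂.le_iff_eq h₁.1).1 (e ▸ le_sup_right))), coe_top]
  have hG := hcompl.card_mul_card
  rw [hcard2 M₁ M₂ h₁ h₂ h12, hcard2 M₂ M₁ h₂ h₁ h12.symm] at hG
  refine ⟨hG.symm, ?_⟩
  refine ((Nat.dvd_prime Nat.prime_two).1 (Monoid.exponent_dvd_of_forall_pow_eq_one hexp)).resolve_left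
    fun h1 => ?_
  have := Monoid.exp_eq_one_iff.1 h1
  rw [Nat.card_of_subsingleton (1 : G)] at hG
  omega

/-- Proper subgroups have order 1 or 2, hence are cyclic: at most four of them, plus ⊤. -/
theorem card_subgroup_of_isKleinFour [IsKleinFour G] : Nat.card (Subgroup G) = 5 := by
  have : Finite G := IsKleinFour.instFinite
  refine le_antisymm ?_ (five_le_card_subgroup IsKleinFour.not_isCyclic).1
  have hsub : (Set.univ : Set (Subgroup G)) ⊆ insert ⊤ (Set.range (zpowers : G → Subgroup G)) := by
    intro H _
    by_cases hH : H = ⊤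
    · exact Or.inl hH
    · right
      have h1 : Nat.card H ∣ 4 := IsKleinFour.card_four (G := G) ▸ card_subgroup_dvd_card H
      have h2 : Nat.card H ≠ 4 := fun e => hH (eq_top_of_card_eq H (e.trans
        (IsKleinFour.card_four (G := G)).symm))
      have h3 : Nat.card H = 1 ∨ Nat.card H = 2 := by
        have := Nat.le_of_dvd (by norm_num) h1
        generalize Nat.card H = n at *
        interval_cases n <;> simp_all
      rcases h3 with h3 | h3
      · exact ⟨1, by rw [card_eq_one.1 h3]; simp⟩
      · have : Fact (Nat.Prime 2) := ⟨Nat.prime_two⟩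
        have := isCyclic_of_prime_card h3
        exact H.isCyclic_iff_exists_zpowers_eq_top.1 this
  have h1 := Set.ncard_le_ncard hsub
  have h2 := Set.ncard_insert_le (⊤ : Subgroup G) (Set.range (zpowers : G → Subgroup G))
  have h3 := Set.ncard_image_le (f := (zpowers : G → Subgroup G)) (s := Set.univ)
  rw [Set.image_univ, Set.ncard_univ, IsKleinFour.card_four] at h3
  rw [Set.ncard_univ] at h1
  omega

end Counting

/-! ### Integers with few divisors, and cyclic groups -/

section Divisors

theorem exists_prime_card_divisors {n : ℕ} (hn : n ≠ 0) (h1 : n ≠ 1) :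
    ∃ p a m : ℕ, p.Prime ∧ 0 < a ∧ p.Coprime m ∧ m ≠ 0 ∧ n = p ^ a * m ∧
      n.divisors.card = (a + 1) * m.divisors.card := by
  obtain ⟨p, hp, hpn⟩ := Nat.exists_prime_and_dvd h1
  obtain ⟨a, m, hpm, rfl⟩ := Nat.exists_eq_pow_mul_and_not_dvd hn p hp.ne_one
  have hc : p.Coprime m := (Nat.Prime.coprime_iff_not_dvd hp).2 hpm
  refine ⟨p, a, m, hp, ?_, hc, right_ne_zero_of_mul hn, rfl, ?_⟩
  · rcases Nat.eq_zero_or_pos a with rfl | h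
    · simp_all
    · exact h
  · rw [Nat.Coprime.card_divisors_mul (hc.pow_left a), Nat.divisors_prime_pow hp,
      Finset.card_map, Finset.card_range]

theorem card_divisors_eq_one {n : ℕ} (hn : n ≠ 0) (h : n.divisors.card = 1) : n = 1 := by
  by_contra h1
  obtain ⟨p, a, m, -, ha, -, hm, -, hd⟩ := exists_prime_card_divisors hn h1
  have : 0 < m.divisors.card := Finset.card_pos.2 ⟨1, by simpa using hm⟩
  nlinarith

theorem exists_of_card_divisors_eq {n k : ℕ} (hn : n ≠ 0) (h : n.divisors.card = k + 2)
    (hk : (k + 2).Prime) : ∃ p : ℕ, p.Prime ∧ n = p ^ (k + 1) := by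
  have h1 : n ≠ 1 := by rintro rfl; simp at h
  obtain ⟨p, a, m, hp, ha, -, hm, rfl, hd⟩ := exists_prime_card_divisors hn h1
  rw [h] at hd
  have hm1 : m.divisors.card = 1 :=
    ((Nat.prime_mul_iff.1 (hd ▸ hk)).resolve_right fun h => by omega).2
  rw [hm1] at hd
  refine ⟨p, hp, ?_⟩
  rw [card_divisors_eq_one hm hm1, mul_one]
  congr 1
  omega

theorem exists_of_card_divisors_eq_four {n : ℕ} (hn : n ≠ 0) (h : n.divisors.card = 4) :
    (∃ p : ℕ, p.Prime ∧ n = p ^ 3) ∨ ∃ p q : ℕ, p.Prime ∧ q.Prime ∧ p ≠ q ∧ n = p * q := by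
  have h1 : n ≠ 1 := by rintro rfl; simp at h
  obtain ⟨p, a, m, hp, ha, hpm, hm, rfl, hd⟩ := exists_prime_card_divisors hn h1
  rw [h] at hd
  have ha3 : a + 1 ∣ 4 := ⟨_, hd⟩
  have hle := Nat.le_of_dvd (by norm_num) ha3
  obtain rfl | rfl : a = 1 ∨ a = 3 := by
    have h2 : a ≠ 2 := by
      rintro rfl
      omega
    omega
  · right
    obtain ⟨q, hq, rfl⟩ := exists_of_card_divisors_eq (k := 0) hm (by omega) Nat.prime_two
    refine ⟨p, q, hp, hq, ?_, by simp⟩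
    rintro rfl
    exact hp.ne_one (by simpa using hpm)
  · left
    refine ⟨p, hp, ?_⟩
    rw [card_divisors_eq_one hm (by omega), mul_one]

end Divisors

section Cyclic

variable {G : Type*} [Group G]

theorem nonempty_mulEquiv_cyc [IsCyclic G] {n : ℕ} (h : Nat.card G = n) :
    Nonempty (G ≃* Cyc n) :=
  ⟨mulEquivOfCyclicCardEq (h.trans (Nat.card_zmod n).symm)⟩

theorem normalizerDefect_cyc {n : ℕ} (hn : n ≠ 0) (e : Nonempty (G ≃* Cyc n)) :
    normalizerDefect G + 1 = n.divisors.card := by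
  have : NeZero n := ⟨hn⟩
  have : Finite (Cyc n) := inferInstanceAs (Finite (ZMod n))
  obtain ⟨e⟩ := e
  rw [normalizerDefect_congr e, normalizerDefect_add_one_of_comm mul_comm,
    card_subgroup_of_isCyclic]
  congr 2
  exact Nat.card_zmod n

end Cyclic

/-! ### Semidirect products of cyclic groups -/

section Semidirect

variable {G : Type*} [Group G]

theorem isNontrivialSemidirect_of_isComplement' {K P : Subgroup G} [K.Normal]
    (h : K.IsComplement' P) (hP : ¬ P.Normal) [IsCyclic K] [IsCyclic P] {m n : ℕ}
    (hm : Nat.card K = m) (hn : Nat.card P = n) : IsNontrivialSemidirect G m n := by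
  obtain ⟨eK⟩ := nonempty_mulEquiv_cyc hm
  obtain ⟨eP⟩ := nonempty_mulEquiv_cyc hn
  have e := (SemidirectProduct.mulEquivSubgroup h).symm.trans
    (SemidirectProduct.congr' (fn := eK) (fg := eP))
  refine ⟨_, fun h1 => hP ?_, ⟨e⟩⟩
  rw [h1] at e
  have e' := e.trans SemidirectProduct.mulEquivProd
  have hcomm : ∀ a b : G, a * b = b * a := fun a b =>
    e'.injective (by rw [map_mul, map_mul, mul_comm])
  exact ⟨fun x hx g => by rwa [hcomm g x, mul_inv_cancel_right]⟩

theorem Cyc.pow_eq_one {n : ℕ} (g : Cyc n) : g ^ n = 1 := by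
  have h : Nat.card (Cyc n) = n := Nat.card_zmod n
  calc g ^ n = g ^ Nat.card (Cyc n) := by rw [h]
    _ = 1 := pow_card_eq_one'

/-- The action yields an automorphism of order p, and |Aut| = r^(k-1)(r-1). -/
theorem IsNontrivialSemidirect.dvd_sub_one {r k p : ℕ} (hr : r.Prime) (hp : p.Prime)
    (hpr : p ≠ r) (hk : 0 < k) (h : IsNontrivialSemidirect G (r ^ k) p) : p ∣ r - 1 := by
  obtain ⟨φ, hφ, -⟩ := h
  obtain ⟨g, hg⟩ : ∃ g, φ g ≠ 1 := by
    by_contra! hc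
    exact hφ (MonoidHom.ext hc)
  have : NeZero (r ^ k) := ⟨pow_ne_zero _ hr.ne_zero⟩
  have : Finite (Cyc (r ^ k)) := inferInstanceAs (Finite (ZMod (r ^ k)))
  have hcard : ∀ n : ℕ, Nat.card (Cyc n) = n := fun n => Nat.card_zmod n
  have hgp : φ g ^ p = 1 := by
    rw [← map_pow, Cyc.pow_eq_one, map_one]
  have : Fact p.Prime := ⟨hp⟩
  have hord : p ∣ Nat.card (MulAut (Cyc (r ^ k))) :=
    orderOf_eq_prime hgp hg ▸ orderOf_dvd_natCard (φ g)
  rw [IsCyclic.card_mulAut, hcard, Nat.totient_prime_pow hr hk] at hord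
  exact (hp.dvd_mul.1 hord).resolve_left fun h =>
    hpr ((Nat.prime_dvd_prime_iff_eq hp hr).1 (hp.dvd_of_dvd_pow h))

theorem ZMod.isNilpotent_of_not_isUnit {p k : ℕ} (hp : p.Prime) {a : ZMod (p ^ k)}
    (ha : ¬ IsUnit a) : IsNilpotent a := by
  have : NeZero (p ^ k) := ⟨pow_ne_zero _ hp.ne_zero⟩
  have h1 : p ∣ a.val := by
    by_contra h
    apply ha
    rw [← ZMod.natCast_zmod_val a, ZMod.isUnit_iff_coprime]
    exact Nat.Coprime.pow_right _ ((Nat.Prime.coprime_iff_not_dvd hp).2 h).symm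
  obtain ⟨c, hc⟩ := h1
  refine ⟨k, ?_⟩
  rw [← ZMod.natCast_zmod_val a, hc, Nat.cast_mul, mul_pow, ← Nat.cast_pow, ZMod.natCast_self,
    zero_mul]

/-- If u - 1 is a unit, cancel it. Otherwise it is nilpotent, so 1 + u + … + u^(q-1) is q plus a
nilpotent, a unit. Its product with u - 1 is u^q - 1 = 0, forcing u = 1. -/
theorem ZMod.eq_zero_of_mul_eq_self {p q k : ℕ} (hp : p.Prime) (hpq : q.Coprime p)
    {u x : ZMod (p ^ k)} (hu : u ^ q = 1) (hu1 : u ≠ 1) (hx : u * x = x) : x = 0 := by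
  by_cases h : IsUnit (u - 1)
  · rw [← h.mul_right_eq_zero, sub_mul, hx, one_mul, sub_self]
  · have hn := ZMod.isNilpotent_of_not_isUnit hp h
    exfalso
    have h1 : (∑ i ∈ Finset.range q, u ^ i) * (u - 1) = 0 := by rw [geom_sum_mul, hu, sub_self]
    have h2 : IsUnit ((q : ZMod (p ^ k)) + ∑ i ∈ Finset.range q, (u ^ i - 1)) := by
      refine IsNilpotent.isUnit_add_left_of_commute ?_ ?_ (Commute.all _ _)
      · have : (u - 1) ∣ ∑ i ∈ Finset.range q, (u ^ i - 1) :=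
          Finset.dvd_sum fun i _ => by simpa using sub_dvd_pow_sub_pow u 1 i
        obtain ⟨c, hc⟩ := this
        rw [hc]
        exact (Commute.all _ _).isNilpotent_mul_right hn
      · rw [ZMod.isUnit_iff_coprime]
        exact hpq.pow_right _
    rw [Finset.sum_sub_distrib, Finset.sum_const, Finset.card_range, nsmul_eq_mul, mul_one,
      add_sub_cancel] at h2
    exact hu1 (sub_eq_zero.1 (h2.mul_right_eq_zero.1 h1))

/-- σ is multiplication by u = σ(1), which reduces the claim to `ZMod.eq_zero_of_mul_eq_self`. -/
theorem MulAut.eq_one_of_apply_eq_self {p q k : ℕ} (hp : p.Prime) (hpq : q.Coprime p)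
    {σ : MulAut (Cyc (p ^ k))} (hσ : σ ^ q = 1) (hσ1 : σ ≠ 1) {x : Cyc (p ^ k)} (hx : σ x = x) :
    x = 1 := by
  have : NeZero (p ^ k) := ⟨pow_ne_zero _ hp.ne_zero⟩
  set u : ZMod (p ^ k) := (σ (Multiplicative.ofAdd 1)).toAdd with hu
  have key : ∀ y : Cyc (p ^ k), (σ y).toAdd = u * y.toAdd := fun y => by
    have h1 : y = Multiplicative.ofAdd (1 : ZMod (p ^ k)) ^ (y.toAdd).val := by
      rw [← ofAdd_nsmul, nsmul_eq_mul, ZMod.natCast_zmod_val, mul_one, ofAdd_toAdd]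
    conv_lhs => rw [h1]
    rw [map_pow, toAdd_pow, ← hu, nsmul_eq_mul, ZMod.natCast_zmod_val, mul_comm]
  have hpow : ∀ (j : ℕ) (y : Cyc (p ^ k)), ((σ ^ j) y).toAdd = u ^ j * y.toAdd := fun j => by
    induction j with
    | zero => simp
    | succ j ih =>
      intro y
      rw [pow_succ, MulAut.mul_apply, ih, key, pow_succ, mul_assoc]
  have h1 : u ^ q = 1 := by
    have := hpow q (Multiplicative.ofAdd 1)
    rw [hσ] at this
    simpa using this.symm
  have h2 : u ≠ 1 := fun h => hσ1 (by
    ext y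
    apply Multiplicative.toAdd.injective
    rw [key, h, one_mul]
    rfl)
  apply Multiplicative.toAdd.injective
  refine ZMod.eq_zero_of_mul_eq_self hp hpq h1 h2 ?_
  rw [← key, hx]

/-- If k in K normalizes P, its commutators with elements of P lie in K ∩ P = 1, so k centralizes P.
-/
theorem normalizer_eq_self_of_isComplement' {K P : Subgroup G} [K.Normal] (h : K.IsComplement' P)
    (hfix : ∀ x ∈ K, (∀ y ∈ P, x * y = y * x) → x = 1) : normalizer (P : Set G) = P := by
  refine le_antisymm (fun g hg => ?_) le_normalizer
  obtain ⟨⟨k, y⟩, rfl⟩ := h.2 g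
  simp only at hg ⊢
  have hk : (k : G) ∈ normalizer (P : Set G) := by
    have := mul_mem hg (inv_mem (le_normalizer y.2))
    rwa [mul_inv_cancel_right] at this
  have : (k : G) = 1 := hfix k k.2 fun z hz => by
    have h1 : (k : G) * z * (k : G)⁻¹ ∈ P := (mem_normalizer_iff.1 hk z).1 hz
    have h2 : (k : G) * z * (k : G)⁻¹ * z⁻¹ ∈ P := mul_mem h1 (inv_mem hz)
    have h3 : (k : G) * z * (k : G)⁻¹ * z⁻¹ ∈ K := by
      rw [mul_assoc, mul_assoc, ← mul_assoc z]
      exact mul_mem k.2 (‹K.Normal›.conj_mem _ (inv_mem k.2) z)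
    have h4 := disjoint_def.1 h.disjoint h3 h2
    rwa [mul_inv_eq_one, mul_inv_eq_iff_eq_mul] at h4
  rw [this, one_mul]
  exact y.2

/-- A conjugate of H is a subgroup of K of the same order, and a cyclic group has only one. -/
theorem Subgroup.normal_of_le_isCyclic [Finite G] {K H : Subgroup G} [K.Normal] [IsCyclic K]
    (hH : H ≤ K) : H.Normal := by
  rw [← normalizer_eq_top_iff, eq_top_iff]
  intro g _
  rw [mem_normalizer_iff_map_conj_eq]
  have hle : H.map (MulAut.conj g).toMonoidHom ≤ K := by
    rintro _ ⟨x, hx, rfl⟩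
    exact ‹K.Normal›.conj_mem x (hH hx) g
  have hcard : Nat.card (H.map (MulAut.conj g).toMonoidHom) = Nat.card H :=
    Nat.card_congr (H.equivMapOfInjective _ (MulAut.conj g).injective).symm.toEquiv
  have h1 : (H.map (MulAut.conj g).toMonoidHom).subgroupOf K = H.subgroupOf K := by
    apply Subgroup.eq_of_card_eq_of_isCyclic
    rw [Nat.card_congr (subgroupOfEquivOfLe hle).toEquiv,
      Nat.card_congr (subgroupOfEquivOfLe hH).toEquiv, hcard]
  have h2 := congrArg (Subgroup.map K.subtype) h1
  rwa [subgroupOf_map_subtype, subgroupOf_map_subtype, inf_eq_left.2 hle, inf_eq_left.2 hH] at h2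

theorem IsNontrivialSemidirect.normalizerDefect_eq {p q k : ℕ} (hp : p.Prime) (hq : q.Prime)
    (hqp : q ∣ p - 1) (h : IsNontrivialSemidirect G (p ^ k) q) : normalizerDefect G = k + 1 := by
  obtain ⟨φ, hφ, ⟨e⟩⟩ := h
  have : Fact q.Prime := ⟨hq⟩
  have : NeZero (p ^ k) := ⟨pow_ne_zero _ hp.ne_zero⟩
  have : NeZero q := ⟨hq.ne_zero⟩
  have : Finite (Cyc (p ^ k)) := inferInstanceAs (Finite (ZMod (p ^ k)))
  have : Finite (Cyc q) := inferInstanceAs (Finite (ZMod q))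
  have : Finite (Cyc (p ^ k) ⋊[φ] Cyc q) := Finite.of_equiv _ SemidirectProduct.equivProd.symm
  have hcard : ∀ n : ℕ, Nat.card (Cyc n) = n := fun n => Nat.card_zmod n
  have hcop : q.Coprime p := by
    rw [Nat.coprime_primes hq hp]
    rintro rfl
    have := Nat.le_of_dvd (by have := hp.two_le; omega) hqp
    have := hp.two_le
    omega
  rw [normalizerDefect_congr e]
  set K := (SemidirectProduct.inl : Cyc (p ^ k) →* Cyc (p ^ k) ⋊[φ] Cyc q).range with hK
  set P := (SemidirectProduct.inr : Cyc q →* Cyc (p ^ k) ⋊[φ] Cyc q).range with hPdef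
  have hKn : K.Normal := by
    rw [hK, SemidirectProduct.range_inl_eq_ker_rightHom]
    infer_instance
  let eK : Cyc (p ^ k) ≃* K := MonoidHom.ofInjective SemidirectProduct.inl_injective
  have hKcard : Nat.card K = p ^ k := (Nat.card_congr eK.symm.toEquiv).trans (hcard _)
  have hPcard : Nat.card P = q := (Nat.card_congr
    (MonoidHom.ofInjective SemidirectProduct.inr_injective).symm.toEquiv).trans (hcard _)
  have hKcyc : IsCyclic K := eK.isCyclic.1 inferInstance
  have hcompl : K.IsComplement' P := by
    refine isComplement'_of_coprime ?_ ?_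
    · rw [hKcard, hPcard, SemidirectProduct.card, hcard, hcard]
    · rw [hKcard, hPcard]
      exact hcop.symm.pow_left _
  have hPq : IsPGroup q P := IsPGroup.of_card (n := 1) (by rw [hPcard, pow_one])
  have hidx : ¬ q ∣ P.index := by
    rw [hcompl.index_eq_card, hKcard]
    exact (Nat.Prime.coprime_iff_not_dvd hq).1 (hcop.pow_right _)
  have hN : normalizer ((hPq.toSylow hidx : Sylow q _) : Set (Cyc (p ^ k) ⋊[φ] Cyc q)) =
      hPq.toSylow hidx := by
    apply normalizer_eq_self_of_isComplement' hcompl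
    rintro _ ⟨n, rfl⟩ hn
    obtain ⟨g, hg⟩ : ∃ g, φ g ≠ 1 := by
      by_contra! hc
      exact hφ (MonoidHom.ext hc)
    have hgq : φ g ^ q = 1 := by
      rw [← map_pow, Cyc.pow_eq_one, map_one]
    have h1 := hn (SemidirectProduct.inr g) ⟨g, rfl⟩
    have h2 : φ g n = n := by
      apply SemidirectProduct.inl_injective (φ := φ)
      rw [SemidirectProduct.inl_aut, ← h1, mul_assoc, ← map_mul, mul_inv_cancel, map_one, mul_one]
    rw [MulAut.eq_one_of_apply_eq_self hp hcop hgq hg h2, map_one]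
  have hmain := normalizerDefect_of_forall_normal (P := hPq.toSylow hidx)
    (hcompl.symm.index_eq_card.trans hPcard) hPcard hN
    fun H hH => Subgroup.normal_of_le_isCyclic hH
  rw [hmain, card_subgroup_of_isCyclic, hKcard, Nat.divisors_prime_pow hp, Finset.card_map,
    Finset.card_range]

end Semidirect

/-! ### The alternating group of degree four -/

section AlternatingFour

/-- P has prime order 3 and is not normal, so its core is trivial. G then embeds in S₄ with index 2,
and A₄ is the only such subgroup. -/
theorem nonempty_mulEquiv_alternatingGroup {G : Type*} [Group G] [Finite G] {P : Subgroup G}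
    (hG : Nat.card G = 12) (hP : P.index = 4) (hPn : ¬ P.Normal) :
    Nonempty (G ≃* alternatingGroup (Fin 4)) := by
  classical
  have hP3 : Nat.card P = 3 := by
    have := P.card_mul_index
    rw [hG, hP] at this
    omega
  have hcore : P.normalCore = ⊥ := by
    have h1 : Nat.card P.normalCore ∣ 3 := hP3 ▸ card_dvd_of_le P.normalCore_le
    rcases (Nat.dvd_prime Nat.prime_three).1 h1 with h | h
    · exact card_eq_one.1 h
    · exfalso
      apply hPn
      rw [← eq_of_le_of_card_ge P.normalCore_le (hP3.trans h.symm).le]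
      infer_instance
  have : Fintype (G ⧸ P) := Fintype.ofFinite _
  have hcardQ : Fintype.card (G ⧸ P) = 4 := by
    rw [← Nat.card_eq_fintype_card, ← index_eq_card, hP]
  set f := MulAction.toPermHom G (G ⧸ P)
  have hinj : Function.Injective f := by
    rw [← MonoidHom.ker_eq_bot_iff, ← normalCore_eq_ker, hcore]
  have e1 : G ≃* f.range := MonoidHom.ofInjective hinj
  have hrange : f.range.index = 2 := by
    have h1 := f.range.card_mul_index
    rw [← Nat.card_congr e1.toEquiv, hG, Nat.card_perm, Nat.card_eq_fintype_card, hcardQ] at h1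
    have : Nat.factorial 4 = 24 := rfl
    omega
  have h2 := Equiv.Perm.eq_alternatingGroup_of_index_eq_two hrange
  exact ⟨(e1.trans (MulEquiv.subgroupCongr h2)).trans
    (Equiv.altCongrHom (Fintype.equivFinOfCardEq hcardQ))⟩

theorem normalizerDefect_alternatingGroup_four :
    normalizerDefect (alternatingGroup (Fin 4)) = 4 := by
  have h4 : Nat.card (Fin 4) = 4 := Nat.card_fin 4
  set K := alternatingGroup.kleinFour (Fin 4)
  have hKn : K.Normal := alternatingGroup.normal_kleinFour h4
  have hK : IsKleinFour K := alternatingGroup.kleinFour_isKleinFour h4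
  have hsq : ∀ x ∈ K, x * x = 1 := fun x hx =>
    congrArg Subtype.val (IsKleinFour.mul_self (⟨x, hx⟩ : K))
  let c : alternatingGroup (Fin 4) := ⟨Equiv.swap 0 1 * Equiv.swap 1 2, by
    rw [Equiv.Perm.mem_alternatingGroup]
    decide⟩
  -- No involution commutes with the 3-cycle c. This gives both the self-normalizing Sylow subgroup
  -- and the non-normality of order-2 subgroups below.
  have hc : ∀ x : alternatingGroup (Fin 4), x * x = 1 → x * c = c * x → x = 1 := by
    decide
  have hc3 : orderOf c = 3 := by
    have : Fact (Nat.Prime 3) := ⟨Nat.prime_three⟩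
    exact orderOf_eq_prime (by decide) (by decide)
  have hfact : Fact (Nat.Prime 3) := ⟨Nat.prime_three⟩
  have hPcard : Nat.card (zpowers c) = 3 := by rw [Nat.card_zpowers, hc3]
  have hKcard : Nat.card K = 4 := IsKleinFour.card_four
  have hcompl : K.IsComplement' (zpowers c) := by
    refine isComplement'_of_coprime ?_ ?_
    · rw [hKcard, hPcard, alternatingGroup.card_of_card_eq_four h4]
    · rw [hKcard, hPcard]
      decide
  have hP : IsPGroup 3 (zpowers c) := IsPGroup.of_card (n := 1) (by rw [hPcard, pow_one])
  have hidx : ¬ 3 ∣ (zpowers c).index := by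
    rw [hcompl.index_eq_card, hKcard]
    decide
  have hN : normalizer ((hP.toSylow hidx : Sylow 3 _) : Set (alternatingGroup (Fin 4))) =
      hP.toSylow hidx :=
    normalizer_eq_self_of_isComplement' hcompl fun x hx hy =>
      hc x (hsq x hx) (hy c (mem_zpowers c))
  have hcommK : ∀ a b : K, a * b = b * a := by
    have := IsKleinFour.isMulCommutative (G := K)
    exact mul_comm'
  have hex : ∃ H ≤ K, ¬ H.Normal := by
    by_contra! hall
    obtain ⟨x, hx, hx1⟩ := K.bot_or_exists_ne_one.resolve_left fun h => by
      rw [h, card_bot] at hKcard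
      omega
    have hn := hall (zpowers x) (by simpa using hx)
    obtain ⟨i, hi⟩ := mem_zpowers_iff.1 (hn.conj_mem x (mem_zpowers x) c)
    apply hx1
    apply hc x (hsq x hx)
    rcases Int.even_or_odd' i with ⟨j, rfl | rfl⟩
    · rw [zpow_mul, zpow_two, hsq x hx, one_zpow, eq_comm, mul_inv_eq_one] at hi
      exact (hx1 (by simpa using hi)).elim
    · rw [zpow_add, zpow_mul, zpow_two, hsq x hx, one_zpow, one_mul, zpow_one,
        eq_mul_inv_iff_mul_eq] at hi
      exact hi
  have hmain := normalizerDefect_of_exists_not_normal (P := hP.toSylow hidx)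
    (hcompl.symm.index_eq_card.trans hPcard) hPcard hN hcommK hex
  rw [card_subgroup_of_isKleinFour] at hmain
  omega

end AlternatingFour

/-! ### Classification by the value of the defect -/

section Classification

variable {G : Type*} [Group G]

theorem normalizerDefect_eq_of_mulEquiv_cyc_pow {p k : ℕ} (hp : p.Prime)
    (e : Nonempty (G ≃* Cyc (p ^ k))) : normalizerDefect G = k := by
  have := normalizerDefect_cyc (pow_ne_zero _ hp.ne_zero) e
  rw [Nat.divisors_prime_pow hp, Finset.card_map, Finset.card_range] at this
  omega

theorem exists_semidirect_of_card_divisors_eq {p m k : ℕ} (hp : p.Prime) (hpm : p.Coprime m)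
    (hm : m ≠ 0) (h : IsNontrivialSemidirect G m p) (hd : m.divisors.card = k + 2)
    (hk : (k + 2).Prime) :
    ∃ r q : ℕ, r.Prime ∧ q.Prime ∧ q ∣ r - 1 ∧ IsNontrivialSemidirect G (r ^ (k + 1)) q := by
  obtain ⟨r, hr, rfl⟩ := exists_of_card_divisors_eq hm hd hk
  refine ⟨r, p, hr, hp, h.dvd_sub_one hr hp ?_ k.succ_pos, h⟩
  rintro rfl
  exact hp.ne_one (by simpa using hpm)

variable [Finite G]

theorem classification_of_normalizerDefect_le (hf : normalizerDefect G ≤ 4) :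
    (∀ a b : G, a * b = b * a) ∨ (normalizerDefect G = 4 ∧ IsZMGroup G) ∨
      (∃ p m : ℕ, p.Prime ∧ p.Coprime m ∧ m ≠ 0 ∧ IsNontrivialSemidirect G m p ∧
        normalizerDefect G = m.divisors.card ∧ IsZMGroup G) ∨
      (normalizerDefect G = 4 ∧ Nonempty (G ≃* alternatingGroup (Fin 4))) := by
  rcases structure_of_normalizerDefect_le hf with h | h |
    ⟨p, hp, K, P, hKn, hcompl, hKcomm, hPp, hN, hPn⟩
  · exact Or.inl h
  · exact Or.inr (Or.inl h)
  right; right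
  have hidx : K.index = p := hcompl.symm.index_eq_card.trans hPp
  have hPK : (P : Subgroup G).index = Nat.card K := hcompl.index_eq_card
  have hPcyc : IsCyclic P := isCyclic_of_prime_card hPp
  have hcop : p.Coprime (Nat.card K) := by
    rw [Nat.Prime.coprime_iff_not_dvd hp.out, ← hPK]
    exact P.not_dvd_index
  -- The defect is |L(K)| or |L(K)| - 1, and a noncyclic K has at least five subgroups. So K is
  -- cyclic in the first case and a Klein four-group in the second.
  by_cases hall : ∀ H ≤ K, H.Normal
  · left
    have hdef := normalizerDefect_of_forall_normal hidx hPp hN hall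
    have hKcyc : IsCyclic K := by
      by_contra hc
      have := (five_le_card_subgroup hc).1
      omega
    refine ⟨p, Nat.card K, hp.out, hcop, Nat.card_pos.ne',
      isNontrivialSemidirect_of_isComplement' hcompl hPn rfl hPp,
      hdef.trans card_subgroup_of_isCyclic, ‹_›, fun hcomm => hPn ⟨fun x hx g => ?_⟩,
      fun r hr R => K.isCyclic_sylow_of_isCyclic P hcompl hr R⟩
    rw [hcomm g x, mul_inv_cancel_right]
    exact hx
  · right
    push Not at hall
    have hdef := normalizerDefect_of_exists_not_normal hidx hPp hN hKcomm hall
    have hKcyc : ¬ IsCyclic K := fun hc => by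
      obtain ⟨H, hH, hHn⟩ := hall
      exact hHn (Subgroup.normal_of_le_isCyclic hH)
    have h5 := (five_le_card_subgroup hKcyc).1
    have hK := isKleinFour_of_card_subgroup_eq_five hKcomm hKcyc (by omega)
    have hKcard : Nat.card K = 4 := IsKleinFour.card_four
    -- There are [G : P] = |K| = 4 Sylow p-subgroups, so 4 ≡ 1 mod p.
    have hp3 : p = 3 := by
      have h1 := card_sylow_modEq_one p G
      rw [P.card_eq_index_normalizer, hN, hPK, hKcard] at h1
      have h2 : p ∣ 3 := (Nat.modEq_iff_dvd' (by norm_num)).1 h1.symm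
      exact (Nat.prime_dvd_prime_iff_eq hp.out Nat.prime_three).1 h2
    refine ⟨by omega, nonempty_mulEquiv_alternatingGroup ?_ (hPK.trans hKcard) hPn⟩
    rw [← hcompl.card_mul_card, hKcard, hPp, hp3]

theorem isCyclic_of_comm_of_normalizerDefect_lt (hcomm : ∀ a b : G, a * b = b * a)
    (hf : normalizerDefect G < 4) : IsCyclic G := by
  by_contra hc
  have h1 := (five_le_card_subgroup hc).1
  have h2 := normalizerDefect_add_one_of_comm hcomm
  omega

theorem card_divisors_of_isCyclic [IsCyclic G] :
    (Nat.card G).divisors.card = normalizerDefect G + 1 := by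
  rw [normalizerDefect_add_one_of_comm mul_comm', card_subgroup_of_isCyclic]

theorem exists_mulEquiv_cyc_of_normalizerDefect_eq [IsCyclic G] {k : ℕ}
    (hf : normalizerDefect G = k + 1) (hk : (k + 2).Prime) :
    ∃ p : ℕ, p.Prime ∧ Nonempty (G ≃* Cyc (p ^ (k + 1))) := by
  obtain ⟨p, hp, h⟩ := exists_of_card_divisors_eq (n := Nat.card G) (k := k) Nat.card_pos.ne'
    (by rw [card_divisors_of_isCyclic, hf]) hk
  exact ⟨p, hp, nonempty_mulEquiv_cyc h⟩

theorem normalizerDefect_eq_one_iff :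
    normalizerDefect G = 1 ↔ ∃ p : ℕ, p.Prime ∧ Nonempty (G ≃* Cyc p) := by
  constructor
  · intro hf
    rcases classification_of_normalizerDefect_le (G := G) (by omega) with h | h |
      ⟨p, m, -, -, hm, hs, hd, -⟩ | h
    · have := isCyclic_of_comm_of_normalizerDefect_lt h (by omega)
      obtain ⟨p, hp, e⟩ := exists_mulEquiv_cyc_of_normalizerDefect_eq (k := 0) hf Nat.prime_two
      exact ⟨p, hp, by rwa [zero_add, pow_one] at e⟩
    · omega
    -- Here the kernel is trivial, so it admits no nontrivial action.
    · obtain rfl := card_divisors_eq_one hm (hd.symm.trans hf)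
      obtain ⟨φ, hφ, -⟩ := hs
      have : Subsingleton (Cyc 1) := inferInstanceAs (Subsingleton (ZMod 1))
      exact (hφ (MonoidHom.ext fun x => MulEquiv.ext fun y => Subsingleton.elim _ _)).elim
    · omega
  · rintro ⟨p, hp, e⟩
    exact normalizerDefect_eq_of_mulEquiv_cyc_pow (k := 1) hp (by rwa [pow_one])

theorem normalizerDefect_eq_two_iff :
    normalizerDefect G = 2 ↔ (∃ p : ℕ, p.Prime ∧ Nonempty (G ≃* Cyc (p ^ 2))) ∨
      (∃ p q : ℕ, p.Prime ∧ q.Prime ∧ q ∣ p - 1 ∧ IsNontrivialSemidirect G p q) := by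
  constructor
  · intro hf
    rcases classification_of_normalizerDefect_le (G := G) (by omega) with h | h |
      ⟨p, m, hp, hpm, hm, hs, hd, -⟩ | h
    · have := isCyclic_of_comm_of_normalizerDefect_lt h (by omega)
      exact Or.inl (exists_mulEquiv_cyc_of_normalizerDefect_eq (k := 1) hf Nat.prime_three)
    · omega
    · right
      simpa using exists_semidirect_of_card_divisors_eq (k := 0) hp hpm hm hs (hd.symm.trans hf)
        Nat.prime_two
    · omega
  · rintro (⟨p, hp, e⟩ | ⟨p, q, hp, hq, hqp, h⟩)
    · exact normalizerDefect_eq_of_mulEquiv_cyc_pow hp e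
    · exact IsNontrivialSemidirect.normalizerDefect_eq (k := 1) hp hq hqp (by rwa [pow_one])

theorem normalizerDefect_eq_three_iff :
    normalizerDefect G = 3 ↔ (∃ p : ℕ, p.Prime ∧ Nonempty (G ≃* Cyc (p ^ 3))) ∨
      (∃ p q : ℕ, p.Prime ∧ q.Prime ∧ p ≠ q ∧ Nonempty (G ≃* Cyc (p * q))) ∨
      (∃ p q : ℕ, p.Prime ∧ q.Prime ∧ q ∣ p - 1 ∧ IsNontrivialSemidirect G (p ^ 2) q) := by
  constructor
  · intro hf
    rcases classification_of_normalizerDefect_le (G := G) (by omega) with h | h |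
      ⟨p, m, hp, hpm, hm, hs, hd, -⟩ | h
    · have := isCyclic_of_comm_of_normalizerDefect_lt h (by omega)
      rcases exists_of_card_divisors_eq_four (n := Nat.card G) Nat.card_pos.ne'
        (by rw [card_divisors_of_isCyclic, hf]) with ⟨p, hp, hc⟩ | ⟨p, q, hp, hq, hpq, hc⟩
      · exact Or.inl ⟨p, hp, nonempty_mulEquiv_cyc hc⟩
      · exact Or.inr (Or.inl ⟨p, q, hp, hq, hpq, nonempty_mulEquiv_cyc hc⟩)
    · omega
    · exact Or.inr (Or.inr (exists_semidirect_of_card_divisors_eq (k := 1) hp hpm hm hs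
        (hd.symm.trans hf) Nat.prime_three))
    · omega
  · rintro (⟨p, hp, e⟩ | ⟨p, q, hp, hq, hpq, e⟩ | ⟨p, q, hp, hq, hqp, h⟩)
    · exact normalizerDefect_eq_of_mulEquiv_cyc_pow hp e
    · have := normalizerDefect_cyc (mul_ne_zero hp.ne_zero hq.ne_zero) e
      rw [Nat.Coprime.card_divisors_mul ((Nat.coprime_primes hp hq).2 hpq), hp.divisors,
        hq.divisors, Finset.card_pair hp.ne_one.symm, Finset.card_pair hq.ne_one.symm] at this
      omega
    · exact IsNontrivialSemidirect.normalizerDefect_eq hp hq hqp h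

theorem isKleinFour_cyc_two_prod : IsKleinFour (Cyc 2 × Cyc 2) where
  card_four := by
    rw [Nat.card_prod]
    have : Nat.card (Cyc 2) = 2 := Nat.card_zmod 2
    rw [this]
  exponent_two := by
    have : Monoid.exponent (Cyc 2) = 2 := by
      rw [IsCyclic.exponent_eq_card]
      exact Nat.card_zmod 2
    rw [Monoid.exponent_prod, this]
    rfl

theorem normalizerDefect_eq_four_iff (hG : ¬ IsZMGroup G) :
    normalizerDefect G = 4 ↔ (∃ p : ℕ, p.Prime ∧ Nonempty (G ≃* Cyc (p ^ 4))) ∨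
      Nonempty (G ≃* Cyc 2 × Cyc 2) ∨ Nonempty (G ≃* alternatingGroup (Fin 4)) := by
  have hV := isKleinFour_cyc_two_prod
  constructor
  · intro hf
    rcases classification_of_normalizerDefect_le (G := G) hf.le with h | h |
      ⟨p, m, -, -, -, -, -, h⟩ | h
    · by_cases hc : IsCyclic G
      · exact Or.inl (exists_mulEquiv_cyc_of_normalizerDefect_eq (k := 3) hf Nat.prime_five)
      · have h1 := normalizerDefect_add_one_of_comm h
        have := isKleinFour_of_card_subgroup_eq_five h hc (by omega)
        exact Or.inr (Or.inl IsKleinFour.nonempty_mulEquiv)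
    · exact (hG h.2).elim
    · exact (hG h).elim
    · exact Or.inr (Or.inr h.2)
  · rintro (⟨p, hp, e⟩ | ⟨⟨e⟩⟩ | ⟨⟨e⟩⟩)
    · exact normalizerDefect_eq_of_mulEquiv_cyc_pow hp e
    · have : Finite (Cyc 2 × Cyc 2) := Finite.of_equiv G e.toEquiv
      have h1 := normalizerDefect_add_one_of_comm (G := Cyc 2 × Cyc 2) mul_comm
      rw [card_subgroup_of_isKleinFour] at h1
      rw [normalizerDefect_congr e]
      omega
    · rw [normalizerDefect_congr e, normalizerDefect_alternatingGroup_four]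

end Classification

theorem theorem1p2 (G : Type*) [Group G] [Finite G] :
    ((((normalizerSet G).ncard : ℤ) = (Nat.card (Subgroup G) : ℤ) - 1) ↔
      ∃ p : ℕ, p.Prime ∧ Nonempty (G ≃* Cyc p)) ∧
    ((((normalizerSet G).ncard : ℤ) = (Nat.card (Subgroup G) : ℤ) - 2) ↔
      (∃ p : ℕ, p.Prime ∧ Nonempty (G ≃* Cyc (p ^ 2))) ∨
      (∃ p q : ℕ, p.Prime ∧ q.Prime ∧ q ∣ p - 1 ∧ IsNontrivialSemidirect G p q)) ∧
    ((((normalizerSet G).ncard : ℤ) = (Nat.card (Subgroup G) : ℤ) - 3) ↔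
      (∃ p : ℕ, p.Prime ∧ Nonempty (G ≃* Cyc (p ^ 3))) ∨
      (∃ p q : ℕ, p.Prime ∧ q.Prime ∧ p ≠ q ∧ Nonempty (G ≃* Cyc (p * q))) ∨
      (∃ p q : ℕ, p.Prime ∧ q.Prime ∧ q ∣ p - 1 ∧ IsNontrivialSemidirect G (p ^ 2) q)) ∧
    (¬ IsZMGroup G →
      ((((normalizerSet G).ncard : ℤ) = (Nat.card (Subgroup G) : ℤ) - 4) ↔
        (∃ p : ℕ, p.Prime ∧ Nonempty (G ≃* Cyc (p ^ 4))) ∨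
        Nonempty (G ≃* Cyc 2 × Cyc 2) ∨
        Nonempty (G ≃* alternatingGroup (Fin 4)))) := by
  exact ⟨(ncard_eq_card_sub_iff G 1).trans normalizerDefect_eq_one_iff,
    (ncard_eq_card_sub_iff G 2).trans normalizerDefect_eq_two_iff,
    (ncard_eq_card_sub_iff G 3).trans normalizerDefect_eq_three_iff,
    fun hG => (ncard_eq_card_sub_iff G 4).trans (normalizerDefect_eq_four_iff hG)⟩
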